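/- Let $N\ge 2$ be an integer, $\mu>0$, and let $(c_j)_{j\ge 0}$ be positive real numbers with $\sum_{j\ge0} c_jN^{-j/\mu}<\infty$. Put $$D=\Big(\sum_{j\ge 0}c_jN^{-j/\mu}\Big)^{-1},\qquad r_j=D\,\frac{c_{j-1}}{N^{(j-1)/\mu}}\quad(j\ge 1),\qquad d_j=\frac{N}{N-1}\,c_j+\sum_{i=j+1}^\infty \frac{c_i}{N^{(i-j)/\mu}}\quad(j\ge 0).$$ Let $\Omega_N=\bigoplus_{i\ge1}\mathbb Z/N\mathbb Z$ be the hierarchical group, with $|x|=\max\{i:x_i\ne0\}$ for $x\neq 0$ and $|0|=0$. The discrete-time $(\mu,(c_j),N)$-random walk on $\Omega_N$ moves, at each step and independently of its past, from its current site $x$ to $y\ne x$ with probability $r_{|y-x|}/(N^{|y-x|-1}(N-1))$; let $p^{(n)}(x,y)$ be its $n$-step transition probabilities, and let $p_t(x,y)=e^{-t}\sum_{n\ge0}\frac{t^n}{n!}p^{(n)}(x,y)$ be the transition probabilities of its continuous-time version with unit rate holding times. Let $T_t\varphi(x)=\sum_y p_t(x,y)\varphi(y)$, $G\varphi=\int_0^\infty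 T_s\varphi\,ds$ and $G_t\varphi=\int_0^tT_s\varphi\,ds$ for $\varphi\ge 0$, write $A(0,0)=(A1_{\{0\}})(0)$ for an operator $A$, and let $$g_t^{(\mu)}=\frac1{\Gamma(\mu)}\int_0^t s^{\mu-1}p_s(0,0)\,ds .$$ Assume that $d_j\le d_{j+1}$ for all $j$ and that $\sum_{j}d_j^{-\mu}=\infty$. Then $g_t^{(\mu)}<\infty$ for all $t>0$ and $$g_t^{(\mu)}\sim\frac{N-1}{N D^\mu}\sum_{j=0}^{\lfloor \mu\log t/\log N\rfloor}\frac1{d_j^{\mu}}\qquad\text{as }t\to\infty .$$ Moreover, if $\mu=1$, $\mu=2$ or $\mu=3$, then the quantity $G_t(0,0)$, $G_t^2(0,0)$ or $(G_t^2G)(0,0)$, respectively, is finite for all $t>0$ and satisfies the same asymptotic relation (for that value of $\mu$). -/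

import Mathlib

open scoped ENNReal Asymptotics

noncomputable section

namespace HierarchicalWalk

/-- The hierarchical group of order `N`, the direct sum of countably many copies of `ℤ/N`.
The index `i : ℕ` stands for the `(i + 1)`-st coordinate. -/
abbrev HierGroup (N : ℕ) : Type := ℕ →₀ ZMod N

/-- `|x|`: the largest (one-based) position of a non-zero coordinate, and `0` for `x = 0`.
The hierarchical distance of `x` and `y` is `hierNorm (y - x)`. -/
def hierNorm {N : ℕ} (x : HierGroup N) : ℕ := x.support.sup (fun i => i + 1)

/-- The normalizing constant `D = (∑_{j ≥ 0} c_j / N^{j/μ})⁻¹`. -/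
def normConst (N : ℕ) (μ : ℝ) (c : ℕ → ℝ) : ℝ :=
  (∑' j : ℕ, c j / (N : ℝ) ^ ((j : ℝ) / μ))⁻¹

/-- The probability `r_j = D c_{j-1} / N^{(j-1)/μ}` of jumping over distance `j`, `j = 1, 2, …`
(only values at `j ≥ 1` are used). -/
def jumpProb (N : ℕ) (μ : ℝ) (c : ℕ → ℝ) (j : ℕ) : ℝ :=
  normConst N μ c * (c (j - 1) / (N : ℝ) ^ (((j - 1 : ℕ) : ℝ) / μ))

/-- The one-step transition probability of the `(μ, (c_j), N)`-random walk: the distance `j` is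
chosen with probability `r_j`, then the arrival site is uniform among the `N^{j-1} (N - 1)` sites
at that distance. -/
def stepProb (N : ℕ) (μ : ℝ) (c : ℕ → ℝ) (x y : HierGroup N) : ℝ≥0∞ :=
  if x = y then 0
  else ENNReal.ofReal
    (jumpProb N μ c (hierNorm (y - x)) /
      ((N : ℝ) ^ (hierNorm (y - x) - 1) * ((N : ℝ) - 1)))

/-- The `n`-step transition probability `p^{(n)}(x, y)` of the discrete time walk. -/
def nStepProb (N : ℕ) (μ : ℝ) (c : ℕ → ℝ) : ℕ → HierGroup N → HierGroup N → ℝ≥0∞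
  | 0, x, y => if x = y then 1 else 0
  | n + 1, x, y => ∑' z : HierGroup N, nStepProb N μ c n x z * stepProb N μ c z y

/-- The transition probability `p_t(x, y) = e^{-t} ∑_n (t^n / n!) p^{(n)}(x, y)`, `t ≥ 0`, of the
continuous time walk with unit rate holding times. -/
def transProb (N : ℕ) (μ : ℝ) (c : ℕ → ℝ) (t : ℝ) (x y : HierGroup N) : ℝ≥0∞ :=
  ENNReal.ofReal (Real.exp (-t)) *
    ∑' n : ℕ, ENNReal.ofReal (t ^ n / (n.factorial : ℝ)) * nStepProb N μ c n x y

/-- The semigroup `T_t φ (x) = E_x φ(X(t)) = ∑_y p_t(x, y) φ(y)` on non-negative functions. -/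
def semigroup (N : ℕ) (μ : ℝ) (c : ℕ → ℝ) (t : ℝ) (φ : HierGroup N → ℝ≥0∞)
    (x : HierGroup N) : ℝ≥0∞ :=
  ∑' y : HierGroup N, transProb N μ c t x y * φ y

/-- The potential operator `G φ = ∫_0^∞ T_s φ ds`. -/
def potential (N : ℕ) (μ : ℝ) (c : ℕ → ℝ) (φ : HierGroup N → ℝ≥0∞) (x : HierGroup N) : ℝ≥0∞ :=
  ∫⁻ s in Set.Ioi (0 : ℝ), semigroup N μ c s φ x

/-- The incomplete potential operator `G_t φ = ∫_0^t T_s φ ds`. -/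
def incPotential (N : ℕ) (μ : ℝ) (c : ℕ → ℝ) (t : ℝ) (φ : HierGroup N → ℝ≥0∞)
    (x : HierGroup N) : ℝ≥0∞ :=
  ∫⁻ s in Set.Ioc (0 : ℝ) t, semigroup N μ c s φ x

/-- The indicator function of the origin; an operator `A` has `A(0,0) = (A (deltaZero N)) 0`. -/
def deltaZero (N : ℕ) : HierGroup N → ℝ≥0∞ := fun y => if y = 0 then 1 else 0

/-- `G_t(0,0)`. -/
def f1 (N : ℕ) (μ : ℝ) (c : ℕ → ℝ) (t : ℝ) : ℝ≥0∞ :=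
  incPotential N μ c t (deltaZero N) 0

/-- `G_t^2(0,0)`. -/
def f2 (N : ℕ) (μ : ℝ) (c : ℕ → ℝ) (t : ℝ) : ℝ≥0∞ :=
  incPotential N μ c t (incPotential N μ c t (deltaZero N)) 0

/-- `(G_t^2 G)(0,0)`. -/
def f3 (N : ℕ) (μ : ℝ) (c : ℕ → ℝ) (t : ℝ) : ℝ≥0∞ :=
  incPotential N μ c t (incPotential N μ c t (potential N μ c (deltaZero N))) 0

/-- `g_t^{(ζ)} = (1/Γ(ζ)) ∫_0^t s^{ζ-1} p_s(0,0) ds`. -/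
def gInc (N : ℕ) (μ : ℝ) (c : ℕ → ℝ) (ζ t : ℝ) : ℝ≥0∞ :=
  ENNReal.ofReal (1 / Real.Gamma ζ) *
    ∫⁻ s in Set.Ioc (0 : ℝ) t, ENNReal.ofReal (s ^ (ζ - 1)) * transProb N μ c s 0 0

/-- `d_j = c_j (N/(N-1) + (1/c_j) ∑_{i ≥ j+1} c_i / N^{(i-j)/μ})`, `j = 0, 1, …`;
the summation index is `k = i - j - 1`. -/
def dSeq (N : ℕ) (μ : ℝ) (c : ℕ → ℝ) (j : ℕ) : ℝ :=
  c j * ((N : ℝ) / ((N : ℝ) - 1) +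
    1 / c j * ∑' k : ℕ, c (j + 1 + k) / (N : ℝ) ^ (((k : ℝ) + 1) / μ))

/-- The asserted growth function
`(N-1)/(N D^μ) ∑_{j=0}^{⌊μ log t / log N⌋} d_j^{-μ}`. -/
def growth (N : ℕ) (μ : ℝ) (c : ℕ → ℝ) (t : ℝ) : ℝ :=
  ((N : ℝ) - 1) / ((N : ℝ) * normConst N μ c ^ μ) *
    ∑ j ∈ Finset.range (⌊μ * Real.log t / Real.log (N : ℝ)⌋₊ + 1), 1 / dSeq N μ c j ^ μ

end HierarchicalWalk

end

namespace HierarchicalWalk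

/-! ### Balls of the hierarchical group -/

section Ball

variable {N : ℕ}

/-! The balls of the hierarchical group are finite subgroups, so a radial jump law is diagonalized
explicitly by their uniform laws. The difference of the uniform laws on the balls of radius `k` and
`k + 1` is an eigenvector of convolution with the jump law (`hasSum_spectralKernel_mul_jumpLaw`),
and these differences telescope to the unit mass at the origin. Their values at the origin are the
weights `w k = (N-1)/N * N^(-k)`, hence `p_t(0,0) = ∑ w k * exp(-a k * t)` with `a k` equal to one
minus the eigenvalue (`transProb_origin`). The tail sums in `dSeq` are exactly what makes `a k = D *
d_k / b^k`, where `b = N^(1/μ)` (`one_sub_eigenvalue`).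

Each functional then becomes `∑ w k * (a k)^(-μ) * F (a k * t)`: `F` is the normalized incomplete
gamma function for `gInc`, and `(1 - exp(-x))^2` for `f2` and `f3`. Since `(b^k)^μ = N^k` cancels
the geometric weight, the sum equals `(N-1)/(N D^μ) * ∑ d_k^(-μ) * F (D d_k t / b^k)`.

Here `F` is a smooth cutoff: it lies in `[0,1]`, tends to `1` at infinity and is at most `C * x^ν`
with `0 < ν ≤ μ`. As `d_k` is nondecreasing, terms beyond `log t / log b` have a geometrically
bounded total, while all but boundedly many earlier terms have `F` close to `1`. Divergence of `∑
d_k^(-μ)` absorbs the bounded errors (`isEquivalent_tsum_truncated`). -/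

lemma hierNorm_le_iff {x : HierGroup N} {k : ℕ} : hierNorm x ≤ k ↔ ∀ i, k ≤ i → x i = 0 := by
  unfold hierNorm
  rw [Finset.sup_le_iff]
  constructor
  · intro h i hi
    by_contra hx
    have := h i (Finsupp.mem_support_iff.2 hx)
    omega
  · intro h i hi
    by_contra hk
    exact Finsupp.mem_support_iff.1 hi (h i (by omega))

lemma hierNorm_eq_zero_iff {x : HierGroup N} : hierNorm x = 0 ↔ x = 0 := by
  rw [← Nat.le_zero, hierNorm_le_iff]
  constructor
  · intro h
    ext i
    simpa using congrArg id (h i (Nat.zero_le i))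
  · rintro rfl i _
    rfl

lemma hierNorm_sub_le {x y : HierGroup N} {k : ℕ} (hx : hierNorm x ≤ k) (hy : hierNorm y ≤ k) :
    hierNorm (x - y) ≤ k := by
  rw [hierNorm_le_iff] at *
  intro i hi
  simp [hx i hi, hy i hi]

/-- Ultrametric triangles are isosceles: if `x - y` and `y` both lay in a smaller ball, so would
their sum `x`. -/
lemma hierNorm_sub_eq {x y : HierGroup N} (h : hierNorm y < hierNorm x) :
    hierNorm (x - y) = hierNorm x := by
  apply le_antisymm (hierNorm_sub_le le_rfl h.le)
  by_contra! hlt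
  obtain ⟨k, hk⟩ : ∃ k, hierNorm x = k + 1 := ⟨hierNorm x - 1, by omega⟩
  have h1 : hierNorm (x - y) ≤ k := by omega
  have h2 : hierNorm y ≤ k := by omega
  have h3 : hierNorm x ≤ k := by
    rw [hierNorm_le_iff] at *
    intro i hi
    have := h1 i hi
    simpa [h2 i hi] using this
  omega

variable [NeZero N]

/-- The ball of radius `k` around the origin. -/
noncomputable def ball (N : ℕ) [NeZero N] (k : ℕ) : Finset (HierGroup N) :=
  (Finset.range k).finsupp fun _ => Finset.univ

lemma mem_ball {k : ℕ} {x : HierGroup N} : x ∈ ball N k ↔ hierNorm x ≤ k := by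
  unfold ball
  rw [Finset.mem_finsupp_iff, hierNorm_le_iff]
  simp only [Finset.mem_univ, implies_true, and_true]
  constructor
  · intro h i hi
    by_contra hx
    have := h (Finsupp.mem_support_iff.2 hx)
    rw [Finset.mem_range] at this
    omega
  · intro h i hi
    rw [Finset.mem_range]
    by_contra hk
    exact Finsupp.mem_support_iff.1 hi (h i (by omega))

lemma card_ball (k : ℕ) : (ball N k).card = N ^ k := by
  unfold ball
  rw [Finset.card_finsupp]
  simp [ZMod.card]

lemma ball_subset {k l : ℕ} (h : k ≤ l) : ball N k ⊆ ball N l := fun _ hx =>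
  mem_ball.2 ((mem_ball.1 hx).trans h)

lemma subset_ball (s : Finset (HierGroup N)) : ∃ k, s ⊆ ball N k :=
  ⟨s.sup hierNorm, fun _ hx => mem_ball.2 (Finset.le_sup (f := hierNorm) hx)⟩

end Ball

/-! ### Spectral decomposition of a radial jump law -/

section Spectral

/-- The mass at `w` of the law of a jump which has distance `i + 1` with probability `ρ i`. -/
noncomputable def jumpLaw (N : ℕ) (ρ : ℕ → ℝ) (w : HierGroup N) : ℝ :=
  if w = 0 then 0 else ρ (hierNorm w - 1) / ((N : ℝ) ^ (hierNorm w - 1) * ((N : ℝ) - 1))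

/-- The eigenvalue of the jump law on the `k`-th spectral component. -/
noncomputable def eigenvalue (N : ℕ) (ρ : ℕ → ℝ) (k : ℕ) : ℝ :=
  ∑ i ∈ Finset.range k, ρ i - ρ k / ((N : ℝ) - 1)

/-- The uniform distribution on the ball of radius `k`. -/
noncomputable def ballLaw (N : ℕ) (k : ℕ) (y : HierGroup N) : ℝ :=
  if hierNorm y ≤ k then ((N : ℝ) ^ k)⁻¹ else 0

/-- The kernel of the `k`-th spectral projection. -/
noncomputable def spectralKernel (N : ℕ) (k : ℕ) (y : HierGroup N) : ℝ :=
  ballLaw N k y - ballLaw N (k + 1) y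

variable {N : ℕ} {ρ : ℕ → ℝ}

lemma jumpLaw_nonneg (hN : 2 ≤ N) (hρ : ∀ i, 0 ≤ ρ i) (w : HierGroup N) :
    0 ≤ jumpLaw N ρ w := by
  have : (2 : ℝ) ≤ N := by exact_mod_cast hN
  unfold jumpLaw
  split_ifs
  · exact le_rfl
  · exact div_nonneg (hρ _) (mul_nonneg (by positivity) (by linarith))

lemma jumpLaw_congr {v w : HierGroup N} (h : hierNorm v = hierNorm w) :
    jumpLaw N ρ v = jumpLaw N ρ w := by
  unfold jumpLaw
  rw [h]
  have : v = 0 ↔ w = 0 := by rw [← hierNorm_eq_zero_iff, h, hierNorm_eq_zero_iff]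
  simp only [this]

lemma jumpLaw_of_norm {w : HierGroup N} {k : ℕ} (h : hierNorm w = k + 1) :
    jumpLaw N ρ w = ρ k / ((N : ℝ) ^ k * ((N : ℝ) - 1)) := by
  have : w ≠ 0 := fun h0 => by
    rw [hierNorm_eq_zero_iff.2 h0] at h
    omega
  simp [jumpLaw, this, h]

variable [NeZero N]

lemma sum_ball_jumpLaw (hN : 2 ≤ N) (k : ℕ) :
    ∑ w ∈ ball N k, jumpLaw N ρ w = ∑ i ∈ Finset.range k, ρ i := by
  have hN' : (2 : ℝ) ≤ N := by exact_mod_cast hN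
  induction k with
  | zero =>
    refine Finset.sum_eq_zero fun w hw => ?_
    have : w = 0 := hierNorm_eq_zero_iff.1 (Nat.le_zero.1 (mem_ball.1 hw))
    simp [jumpLaw, this]
  | succ k ih =>
    rw [Finset.sum_range_succ, ← ih, ← Finset.sum_sdiff (ball_subset (Nat.le_succ k)), add_comm]
    congr 1
    have h1 : ∀ w ∈ ball N (k + 1) \ ball N k,
        jumpLaw N ρ w = ρ k / ((N : ℝ) ^ k * ((N : ℝ) - 1)) := by
      intro w hw
      rw [Finset.mem_sdiff, mem_ball, mem_ball] at hw
      exact jumpLaw_of_norm (by omega)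
    rw [Finset.sum_congr rfl h1, Finset.sum_const, nsmul_eq_mul,
      Finset.cast_card_sdiff (ball_subset (Nat.le_succ k)), card_ball, card_ball]
    have h2 : (N : ℝ) ^ k ≠ 0 := by positivity
    have h3 : (N : ℝ) - 1 ≠ 0 := by linarith
    push_cast
    rw [Nat.succ_eq_add_one, pow_succ]
    field_simp

lemma summable_jumpLaw (hN : 2 ≤ N) (hρ : ∀ i, 0 ≤ ρ i) (hρ1 : HasSum ρ 1) :
    Summable (jumpLaw N ρ) := by
  refine summable_of_sum_le (c := 1) (jumpLaw_nonneg hN hρ) fun s => ?_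
  obtain ⟨k, hk⟩ := subset_ball s
  calc ∑ w ∈ s, jumpLaw N ρ w ≤ ∑ w ∈ ball N k, jumpLaw N ρ w :=
        Finset.sum_le_sum_of_subset_of_nonneg hk fun w _ _ => jumpLaw_nonneg hN hρ w
    _ = ∑ i ∈ Finset.range k, ρ i := sum_ball_jumpLaw hN k
    _ ≤ 1 := sum_le_hasSum _ (fun i _ => hρ i) hρ1

lemma summable_jumpLaw_sub (hN : 2 ≤ N) (hρ : ∀ i, 0 ≤ ρ i) (hρ1 : HasSum ρ 1)
    (y : HierGroup N) : Summable fun z => jumpLaw N ρ (y - z) :=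
  (Equiv.summable_iff (f := jumpLaw N ρ) (Equiv.subLeft y)).2 (summable_jumpLaw hN hρ hρ1)

/-- The ball is a subgroup containing `y`, so `z ↦ y - z` permutes it. -/
lemma sum_ball_jumpLaw_sub_of_le (hN : 2 ≤ N) {k : ℕ} {y : HierGroup N} (hy : hierNorm y ≤ k) :
    ∑ z ∈ ball N k, jumpLaw N ρ (y - z) = ∑ i ∈ Finset.range k, ρ i := by
  rw [← sum_ball_jumpLaw hN]
  refine Finset.sum_nbij' (fun z => y - z) (fun z => y - z) ?_ ?_ ?_ ?_ ?_
  · intro z hz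
    exact mem_ball.2 (hierNorm_sub_le hy (mem_ball.1 hz))
  · intro z hz
    exact mem_ball.2 (hierNorm_sub_le hy (mem_ball.1 hz))
  · intro z _
    abel
  · intro z _
    abel
  · intro z _
    rfl

lemma sum_ball_jumpLaw_sub_of_lt {k : ℕ} {y : HierGroup N} (hy : k < hierNorm y) :
    ∑ z ∈ ball N k, jumpLaw N ρ (y - z) = (N : ℝ) ^ k * jumpLaw N ρ y := by
  have h : ∀ z ∈ ball N k, jumpLaw N ρ (y - z) = jumpLaw N ρ y := fun z hz =>
    jumpLaw_congr (hierNorm_sub_eq ((mem_ball.1 hz).trans_lt hy))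
  rw [Finset.sum_congr rfl h, Finset.sum_const, card_ball, nsmul_eq_mul]
  push_cast
  rfl

lemma hasSum_ballLaw_mul (k : ℕ) (f : HierGroup N → ℝ) :
    HasSum (fun z => ballLaw N k z * f z) (((N : ℝ) ^ k)⁻¹ * ∑ z ∈ ball N k, f z) := by
  rw [Finset.mul_sum]
  have h : ∑ z ∈ ball N k, ((N : ℝ) ^ k)⁻¹ * f z = ∑ z ∈ ball N k, ballLaw N k z * f z := by
    refine Finset.sum_congr rfl fun z hz => ?_
    rw [ballLaw, if_pos (mem_ball.1 hz)]
  rw [h]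
  refine hasSum_sum_of_ne_finset_zero fun z hz => ?_
  rw [mem_ball] at hz
  simp [ballLaw, hz]

/-- Averaging the jump law over a ball around `y` gives its partial mass if the ball contains the
origin, and its value at `y` otherwise. -/
lemma hasSum_spectralKernel_mul_jumpLaw (hN : 2 ≤ N) (k : ℕ) (y : HierGroup N) :
    HasSum (fun z => spectralKernel N k z * jumpLaw N ρ (y - z))
      (eigenvalue N ρ k * spectralKernel N k y) := by
  have hN' : (2 : ℝ) ≤ N := by exact_mod_cast hN
  have h2 : (N : ℝ) ^ k ≠ 0 := by positivity
  have h3 : (N : ℝ) - 1 ≠ 0 := by linarith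
  have h4 : (N : ℝ) ≠ 0 := by linarith
  have h := (hasSum_ballLaw_mul k fun z => jumpLaw N ρ (y - z)).sub
    (hasSum_ballLaw_mul (k + 1) fun z => jumpLaw N ρ (y - z))
  simp only [← sub_mul] at h
  suffices heq : eigenvalue N ρ k * spectralKernel N k y = _ by
    rw [heq]
    exact h
  unfold spectralKernel eigenvalue ballLaw
  -- On the shell `|y| = k + 1` only the larger ball contains `y`; outside both balls the two
  -- averages coincide and cancel.
  rcases lt_trichotomy (hierNorm y) (k + 1) with hy | hy | hy
  · rw [if_pos (by omega), if_pos (by omega), sum_ball_jumpLaw_sub_of_le hN (by omega),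
      sum_ball_jumpLaw_sub_of_le hN (by omega), Finset.sum_range_succ]
    field_simp
    ring
  · rw [if_neg (by omega), if_pos (by omega), sum_ball_jumpLaw_sub_of_lt (by omega),
      sum_ball_jumpLaw_sub_of_le hN (by omega), Finset.sum_range_succ, jumpLaw_of_norm hy]
    field_simp
    ring
  · rw [if_neg (by omega), if_neg (by omega), sum_ball_jumpLaw_sub_of_lt (by omega),
      sum_ball_jumpLaw_sub_of_lt (by omega)]
    field_simp
    ring

omit [NeZero N] in
lemma abs_eigenvalue_le_one (hN : 2 ≤ N) (hρ : ∀ i, 0 ≤ ρ i) (hρ1 : HasSum ρ 1) (k : ℕ) :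
    |eigenvalue N ρ k| ≤ 1 := by
  have hN' : (2 : ℝ) ≤ N := by exact_mod_cast hN
  have h1 : ∑ i ∈ Finset.range k, ρ i ≤ 1 := sum_le_hasSum _ (fun i _ => hρ i) hρ1
  have h2 : 0 ≤ ∑ i ∈ Finset.range k, ρ i := Finset.sum_nonneg fun i _ => hρ i
  have h3 : 0 ≤ ρ k / ((N : ℝ) - 1) := div_nonneg (hρ k) (by linarith)
  have h4 : ρ k ≤ 1 := le_hasSum hρ1 k fun i _ => hρ i
  have h5 : ρ k / ((N : ℝ) - 1) ≤ 1 := by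
    rw [div_le_one (by linarith)]
    linarith
  unfold eigenvalue
  rw [abs_le]
  constructor <;> linarith

/-- With eigenvalues in `[-1,1]`, this geometric majorant, uniform in `y`, justifies the
interchanges of sums. -/
lemma abs_spectralKernel_le (k : ℕ) (y : HierGroup N) :
    |spectralKernel N k y| ≤ ((N : ℝ)⁻¹) ^ k := by
  have h4 : (1 : ℝ) ≤ N := by exact_mod_cast NeZero.one_le
  have h1 : ((N : ℝ) ^ (k + 1))⁻¹ ≤ ((N : ℝ) ^ k)⁻¹ := by
    gcongr
    · omega
  have h2 : 0 < ((N : ℝ) ^ (k + 1))⁻¹ := by positivity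
  rw [inv_pow, abs_le]
  unfold spectralKernel ballLaw
  split_ifs <;> constructor <;> linarith

omit [NeZero N] in
lemma summable_inv_pow (hN : 2 ≤ N) : Summable fun k : ℕ => ((N : ℝ)⁻¹) ^ k := by
  have hN' : (2 : ℝ) ≤ N := by exact_mod_cast hN
  exact summable_geometric_of_lt_one (by positivity) (inv_lt_one_of_one_lt₀ (by linarith))

/-- The real-valued `n`-step transition probability from the origin, in spectral form. -/
noncomputable def spectralProb (N : ℕ) (ρ : ℕ → ℝ) (n : ℕ) (y : HierGroup N) : ℝ :=
  ∑' k, eigenvalue N ρ k ^ n * spectralKernel N k y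

lemma abs_spectral_term_le (hN : 2 ≤ N) (hρ : ∀ i, 0 ≤ ρ i) (hρ1 : HasSum ρ 1) (n k : ℕ)
    (y : HierGroup N) :
    |eigenvalue N ρ k ^ n * spectralKernel N k y| ≤ ((N : ℝ)⁻¹) ^ k := by
  rw [abs_mul, abs_pow, ← one_mul (((N : ℝ)⁻¹) ^ k)]
  exact mul_le_mul (pow_le_one₀ (abs_nonneg _) (abs_eigenvalue_le_one hN hρ hρ1 k))
    (abs_spectralKernel_le k y) (abs_nonneg _) zero_le_one

/-- The kernels telescope: the ball of radius zero is the origin, and the uniform laws tend to zero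
pointwise. -/
lemma spectralProb_zero (hN : 2 ≤ N) (y : HierGroup N) :
    spectralProb N ρ 0 y = if 0 = y then 1 else 0 := by
  have hN' : (2 : ℝ) ≤ N := by exact_mod_cast hN
  have hlim : Filter.Tendsto (fun n => ballLaw N n y) Filter.atTop (nhds 0) := by
    refine squeeze_zero (g := fun n => ((N : ℝ)⁻¹) ^ n) (fun n => ?_) (fun n => ?_)
      (tendsto_pow_atTop_nhds_zero_of_lt_one (by positivity)
        (inv_lt_one_of_one_lt₀ (by linarith)))
    · unfold ballLaw
      split_ifs <;> positivity
    · unfold ballLaw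
      rw [inv_pow]
      split_ifs
      · exact le_rfl
      · positivity
  have hs : Summable fun k => spectralKernel N k y :=
    Summable.of_norm_bounded (summable_inv_pow hN) fun k => abs_spectralKernel_le k y
  have h1 : HasSum (fun k => spectralKernel N k y) (ballLaw N 0 y - 0) := by
    rw [hs.hasSum_iff_tendsto_nat]
    simp only [spectralKernel, Finset.sum_range_sub']
    exact tendsto_const_nhds.sub hlim
  simp only [spectralProb, pow_zero, one_mul]
  rw [h1.tsum_eq]
  simp [ballLaw, hierNorm_eq_zero_iff, eq_comm]

lemma hasSum_spectralProb_succ (hN : 2 ≤ N) (hρ : ∀ i, 0 ≤ ρ i) (hρ1 : HasSum ρ 1) (n : ℕ)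
    (y : HierGroup N) :
    HasSum (fun z => spectralProb N ρ n z * jumpLaw N ρ (y - z)) (spectralProb N ρ (n + 1) y) := by
  set F : HierGroup N × ℕ → ℝ := fun p =>
    eigenvalue N ρ p.2 ^ n * spectralKernel N p.2 p.1 * jumpLaw N ρ (y - p.1) with hF
  have hsum : Summable F := by
    refine Summable.of_norm_bounded
      (g := fun p : HierGroup N × ℕ => jumpLaw N ρ (y - p.1) * ((N : ℝ)⁻¹) ^ p.2)
      (Summable.mul_of_nonneg (f := fun z => jumpLaw N ρ (y - z))
        (g := fun k : ℕ => ((N : ℝ)⁻¹) ^ k) (summable_jumpLaw_sub hN hρ hρ1 y)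
        (summable_inv_pow hN) (fun z => jumpLaw_nonneg hN hρ _) (fun k => by positivity))
      fun p => ?_
    rw [hF, Real.norm_eq_abs, abs_mul, abs_of_nonneg (jumpLaw_nonneg hN hρ (y - p.1)), mul_comm]
    exact mul_le_mul_of_nonneg_left (abs_spectral_term_le hN hρ hρ1 n p.2 p.1)
      (jumpLaw_nonneg hN hρ _)
  have h1 : ∀ z, HasSum (fun k => F (z, k)) (spectralProb N ρ n z * jumpLaw N ρ (y - z)) := by
    intro z
    have hz : HasSum (fun k => eigenvalue N ρ k ^ n * spectralKernel N k z)
        (spectralProb N ρ n z) :=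
      (Summable.of_norm_bounded (summable_inv_pow hN)
        fun k => abs_spectral_term_le hN hρ hρ1 n k z).hasSum
    exact hz.mul_right (jumpLaw N ρ (y - z))
  have h2 : ∀ k, HasSum (fun z => F (z, k))
      (eigenvalue N ρ k ^ (n + 1) * spectralKernel N k y) := by
    intro k
    have := (hasSum_spectralKernel_mul_jumpLaw (ρ := ρ) hN k y).mul_left (eigenvalue N ρ k ^ n)
    simpa only [hF, mul_assoc, pow_succ] using this
  have h3 := hsum.hasSum.prod_fiberwise h1
  have h4 := ((Equiv.prodComm ℕ (HierGroup N)).hasSum_iff.2 hsum.hasSum).prod_fiberwise h2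
  rw [spectralProb, h4.tsum_eq]
  exact h3

/-- Eigenvalues and kernels may be negative, so the sign is invisible termwise; it is inherited
through the convolution recursion. It is needed to pass to `ℝ≥0∞`. -/
lemma spectralProb_nonneg (hN : 2 ≤ N) (hρ : ∀ i, 0 ≤ ρ i) (hρ1 : HasSum ρ 1) (n : ℕ)
    (y : HierGroup N) : 0 ≤ spectralProb N ρ n y := by
  induction n generalizing y with
  | zero =>
    rw [spectralProb_zero hN]
    split_ifs <;> norm_num
  | succ n ih =>
    exact (hasSum_spectralProb_succ hN hρ hρ1 n y).nonneg fun z =>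
      mul_nonneg (ih z) (jumpLaw_nonneg hN hρ _)

lemma spectralProb_origin (n : ℕ) :
    spectralProb N ρ n 0 = ∑' k, eigenvalue N ρ k ^ n * (((N : ℝ) - 1) / N * ((N : ℝ)⁻¹) ^ k) := by
  have h4 : (N : ℝ) ≠ 0 := by exact_mod_cast NeZero.ne N
  unfold spectralProb
  refine tsum_congr fun k => ?_
  have h0 : hierNorm (0 : HierGroup N) = 0 := hierNorm_eq_zero_iff.2 rfl
  simp only [spectralKernel, ballLaw, h0, Nat.zero_le, if_true]
  rw [inv_pow, pow_succ]
  field_simp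

omit [NeZero N] in
lemma summable_weight (hN : 2 ≤ N) :
    Summable fun k : ℕ => ((N : ℝ) - 1) / N * ((N : ℝ)⁻¹) ^ k :=
  (summable_inv_pow hN).mul_left _

omit [NeZero N] in
lemma weight_nonneg (hN : 2 ≤ N) (k : ℕ) : 0 ≤ ((N : ℝ) - 1) / N * ((N : ℝ)⁻¹) ^ k := by
  have hN' : (2 : ℝ) ≤ N := by exact_mod_cast hN
  exact mul_nonneg (div_nonneg (by linarith) (by linarith)) (by positivity)

/-- The exponential generating function of the return probabilities. -/
lemma hasSum_exp_spectralProb_origin (hN : 2 ≤ N) (hρ : ∀ i, 0 ≤ ρ i) (hρ1 : HasSum ρ 1) {t : ℝ}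
    (ht : 0 ≤ t) :
    HasSum (fun n : ℕ => t ^ n / (n.factorial : ℝ) * spectralProb N ρ n 0)
      (∑' k, ((N : ℝ) - 1) / N * ((N : ℝ)⁻¹) ^ k * Real.exp (t * eigenvalue N ρ k)) := by
  set w : ℕ → ℝ := fun k => ((N : ℝ) - 1) / N * ((N : ℝ)⁻¹) ^ k with hw
  have hw0 : ∀ k, 0 ≤ w k := weight_nonneg hN
  have hexp : ∀ x : ℝ, HasSum (fun n : ℕ => x ^ n / (n.factorial : ℝ)) (Real.exp x) := fun x => by
    rw [Real.exp_eq_exp_ℝ]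
    exact NormedSpace.expSeries_div_hasSum_exp x
  set F : ℕ × ℕ → ℝ := fun p =>
    t ^ p.1 / (p.1.factorial : ℝ) * (eigenvalue N ρ p.2 ^ p.1 * w p.2) with hF
  have hsum : Summable F := by
    refine Summable.of_norm_bounded
      (g := fun p : ℕ × ℕ => t ^ p.1 / (p.1.factorial : ℝ) * w p.2)
      ((hexp t).summable.mul_of_nonneg (summable_weight hN)
        (fun z => by positivity) hw0) fun p => ?_
    rw [hF, Real.norm_eq_abs, abs_mul, abs_mul, abs_pow, abs_of_nonneg (hw0 _),
      abs_of_nonneg (show (0 : ℝ) ≤ t ^ p.1 / (p.1.factorial : ℝ) by positivity)]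
    refine mul_le_mul_of_nonneg_left ?_ (by positivity)
    exact mul_le_of_le_one_left (hw0 _)
      (pow_le_one₀ (abs_nonneg _) (abs_eigenvalue_le_one hN hρ hρ1 _))
  have h1 : ∀ n, HasSum (fun k => F (n, k))
      (t ^ n / (n.factorial : ℝ) * spectralProb N ρ n 0) := by
    intro n
    rw [spectralProb_origin]
    refine HasSum.mul_left _ (Summable.hasSum ?_)
    refine Summable.of_norm_bounded (summable_weight hN) fun k => ?_
    rw [Real.norm_eq_abs, abs_mul, abs_pow, abs_of_nonneg (weight_nonneg hN _)]
    exact mul_le_of_le_one_left (hw0 _)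
      (pow_le_one₀ (abs_nonneg _) (abs_eigenvalue_le_one hN hρ hρ1 _))
  have h2 : ∀ k, HasSum (fun n => F (n, k)) (w k * Real.exp (t * eigenvalue N ρ k)) := by
    intro k
    have heq : (fun n => F (n, k)) =
        fun n => w k * ((t * eigenvalue N ρ k) ^ n / (n.factorial : ℝ)) := by
      funext n
      simp only [hF, mul_pow]
      ring
    rw [heq]
    exact (hexp (t * eigenvalue N ρ k)).mul_left (w k)
  have h3 := hsum.hasSum.prod_fiberwise h1
  have h4 := ((Equiv.prodComm ℕ ℕ).hasSum_iff.2 hsum.hasSum).prod_fiberwise h2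
  rw [h4.tsum_eq]
  exact h3

end Spectral

end HierarchicalWalk

namespace HierarchicalWalk

open MeasureTheory

/-! ### The semigroup property -/

section Semigroup

variable (N : ℕ) (μ : ℝ) (c : ℕ → ℝ)

lemma nStepProb_add (m n : ℕ) (x y : HierGroup N) :
    nStepProb N μ c (m + n) x y = ∑' z, nStepProb N μ c m x z * nStepProb N μ c n z y := by
  induction n generalizing y with
  | zero =>
    rw [tsum_eq_single y fun z hz => by simp [nStepProb, hz]]
    simp [nStepProb]
  | succ n ih =>
    rw [← add_assoc]
    simp only [nStepProb, ih, ← ENNReal.tsum_mul_left, ← ENNReal.tsum_mul_right]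
    rw [ENNReal.tsum_comm]
    simp only [mul_assoc]

lemma tsum_tsum_eq_tsum_antidiagonal (f : ℕ → ℕ → ℝ≥0∞) :
    ∑' m, ∑' n, f m n = ∑' k, ∑ p ∈ Finset.HasAntidiagonal.antidiagonal k, f p.1 p.2 := by
  rw [← ENNReal.tsum_prod, ← Finset.HasAntidiagonal.sigmaAntidiagonalEquivProd.tsum_eq, ENNReal.tsum_sigma']
  refine tsum_congr fun k => ?_
  rw [tsum_fintype]
  exact Finset.sum_coe_sort (Finset.HasAntidiagonal.antidiagonal k) fun p => f p.1 p.2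

lemma sum_antidiagonal_pow_div_factorial (s t : ℝ) (k : ℕ) :
    ∑ p ∈ Finset.HasAntidiagonal.antidiagonal k,
      s ^ p.1 / (p.1.factorial : ℝ) * (t ^ p.2 / (p.2.factorial : ℝ)) =
      (s + t) ^ k / (k.factorial : ℝ) := by
  rw [(Commute.all s t).add_pow', Finset.sum_div]
  refine Finset.sum_congr rfl fun p hp => ?_
  rw [Finset.HasAntidiagonal.mem_antidiagonal] at hp
  have h := Nat.choose_mul_factorial_mul_factorial (show p.1 ≤ k by omega)
  rw [show k - p.1 = p.2 by omega] at h
  have h' : (k.choose p.1 : ℝ) * (p.1.factorial : ℝ) * (p.2.factorial : ℝ) = k.factorial := by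
    exact_mod_cast h
  have h1 : (k.factorial : ℝ) ≠ 0 := by positivity
  rw [nsmul_eq_mul, div_mul_div_comm, div_eq_div_iff (by positivity) h1, ← h']
  ring

/-- Chapman–Kolmogorov in continuous time: the Cauchy product of the two exponential series,
regrouped by total number of steps and summed by the binomial theorem. -/
lemma transProb_add {s t : ℝ} (hs : 0 ≤ s) (ht : 0 ≤ t) (x y : HierGroup N) :
    transProb N μ c (s + t) x y = ∑' z, transProb N μ c s x z * transProb N μ c t z y := by
  have h1 : ∀ z, transProb N μ c s x z * transProb N μ c t z y =
      ENNReal.ofReal (Real.exp (-(s + t))) * ∑' m : ℕ, ∑' n : ℕ,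
        ENNReal.ofReal (s ^ m / (m.factorial : ℝ)) * ENNReal.ofReal (t ^ n / (n.factorial : ℝ)) *
          (nStepProb N μ c m x z * nStepProb N μ c n z y) := by
    intro z
    unfold transProb
    rw [neg_add, Real.exp_add, ENNReal.ofReal_mul (Real.exp_nonneg _), mul_mul_mul_comm]
    congr 1
    rw [← ENNReal.tsum_mul_right]
    refine tsum_congr fun m => ?_
    rw [← ENNReal.tsum_mul_left]
    refine tsum_congr fun n => ?_
    rw [mul_mul_mul_comm]
  simp only [h1]
  rw [ENNReal.tsum_mul_left, ENNReal.tsum_comm]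
  unfold transProb
  congr 1
  have h2 : ∀ m : ℕ, ∑' z, ∑' n : ℕ,
        ENNReal.ofReal (s ^ m / (m.factorial : ℝ)) * ENNReal.ofReal (t ^ n / (n.factorial : ℝ)) *
          (nStepProb N μ c m x z * nStepProb N μ c n z y) =
      ∑' n : ℕ, ENNReal.ofReal (s ^ m / (m.factorial : ℝ)) *
        ENNReal.ofReal (t ^ n / (n.factorial : ℝ)) * nStepProb N μ c (m + n) x y := by
    intro m
    rw [ENNReal.tsum_comm]
    refine tsum_congr fun n => ?_
    rw [ENNReal.tsum_mul_left, nStepProb_add]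
  simp only [h2]
  rw [tsum_tsum_eq_tsum_antidiagonal fun m n => ENNReal.ofReal (s ^ m / (m.factorial : ℝ)) *
        ENNReal.ofReal (t ^ n / (n.factorial : ℝ)) * nStepProb N μ c (m + n) x y]
  refine tsum_congr fun k => ?_
  rw [← sum_antidiagonal_pow_div_factorial, ENNReal.ofReal_sum_of_nonneg fun p _ => by positivity,
    Finset.sum_mul]
  refine Finset.sum_congr rfl fun p hp => ?_
  rw [Finset.HasAntidiagonal.mem_antidiagonal.1 hp, ENNReal.ofReal_mul (by positivity)]

lemma measurable_transProb (x y : HierGroup N) :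
    Measurable fun t => transProb N μ c t x y := by
  unfold transProb
  refine Measurable.mul (by fun_prop) (Measurable.tsum fun n => ?_)
  exact Measurable.mul_const (by fun_prop) _

lemma semigroup_deltaZero (t : ℝ) (x : HierGroup N) :
    semigroup N μ c t (deltaZero N) x = transProb N μ c t x 0 := by
  unfold semigroup deltaZero
  rw [tsum_eq_single 0 fun z hz => by simp [hz]]
  simp

lemma semigroup_lintegral {α : Type*} [MeasurableSpace α] (m : Measure α)
    {h : HierGroup N → α → ℝ≥0∞} (hh : ∀ y, Measurable (h y)) (t : ℝ) (x : HierGroup N) :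
    semigroup N μ c t (fun y => ∫⁻ u, h y u ∂m) x =
      ∫⁻ u, semigroup N μ c t (fun y => h y u) x ∂m := by
  unfold semigroup
  -- Tonelli for a sum needs countability; `N = 0` is not excluded here, and `ZMod 0` is `ℤ`.
  have hc : Countable (HierGroup N) := by
    rcases Nat.eq_zero_or_pos N with rfl | hN
    · have : Countable (ZMod 0) := inferInstanceAs (Countable ℤ)
      infer_instance
    · have : NeZero N := ⟨hN.ne'⟩
      infer_instance
  rw [lintegral_tsum fun y => ((hh y).const_mul _).aemeasurable]
  refine tsum_congr fun y => ?_
  rw [lintegral_const_mul _ (hh y)]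

lemma semigroup_transProb {s t : ℝ} (hs : 0 ≤ s) (ht : 0 ≤ t) (x : HierGroup N) :
    semigroup N μ c s (fun y => transProb N μ c t y 0) x = transProb N μ c (s + t) x 0 :=
  (transProb_add N μ c hs ht x 0).symm

lemma incPotential_deltaZero (t : ℝ) (x : HierGroup N) :
    incPotential N μ c t (deltaZero N) x = ∫⁻ s in Set.Ioc 0 t, transProb N μ c s x 0 := by
  simp only [incPotential, semigroup_deltaZero]

lemma potential_deltaZero (x : HierGroup N) :
    potential N μ c (deltaZero N) x = ∫⁻ s in Set.Ioi 0, transProb N μ c s x 0 := by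
  simp only [potential, semigroup_deltaZero]

lemma incPotential_lintegral_transProb (t : ℝ) {S : Set ℝ} (hS : MeasurableSet S)
    (hS0 : ∀ u ∈ S, 0 ≤ u) (x : HierGroup N) :
    incPotential N μ c t (fun y => ∫⁻ u in S, transProb N μ c u y 0) x =
      ∫⁻ s in Set.Ioc 0 t, ∫⁻ u in S, transProb N μ c (s + u) x 0 := by
  unfold incPotential
  refine setLIntegral_congr_fun measurableSet_Ioc fun s hs => ?_
  rw [semigroup_lintegral N μ c _ fun y => measurable_transProb N μ c y 0]
  refine setLIntegral_congr_fun hS fun u hu => ?_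
  exact semigroup_transProb N μ c hs.1.le (hS0 u hu) x

lemma f2_eq (t : ℝ) :
    f2 N μ c t = ∫⁻ s in Set.Ioc 0 t, ∫⁻ u in Set.Ioc 0 t, transProb N μ c (s + u) 0 0 := by
  unfold f2
  simp only [funext (incPotential_deltaZero N μ c t)]
  exact incPotential_lintegral_transProb N μ c t measurableSet_Ioc (fun u hu => hu.1.le) 0

lemma f3_eq (t : ℝ) :
    f3 N μ c t = ∫⁻ r in Set.Ioc 0 t, ∫⁻ s in Set.Ioc 0 t, ∫⁻ u in Set.Ioi 0,
      transProb N μ c (r + (s + u)) 0 0 := by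
  have hm : ∀ y : HierGroup N,
      Measurable fun p : ℝ × ℝ => transProb N μ c (p.1 + p.2) y 0 := fun y =>
    (measurable_transProb N μ c y 0).comp (measurable_fst.add measurable_snd)
  unfold f3
  simp only [funext (potential_deltaZero N μ c),
    funext (incPotential_lintegral_transProb N μ c t measurableSet_Ioi
      (fun u (hu : 0 < u) => hu.le))]
  unfold incPotential
  refine setLIntegral_congr_fun measurableSet_Ioc fun r hr => ?_
  rw [semigroup_lintegral N μ c _ fun y => (hm y).lintegral_prod_right']
  refine setLIntegral_congr_fun measurableSet_Ioc fun s hs => ?_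
  refine (semigroup_lintegral N μ c _ (h := fun y u => transProb N μ c (s + u) y 0)
    (fun y => (measurable_transProb N μ c y 0).comp (measurable_const_add s)) r 0).trans ?_
  refine setLIntegral_congr_fun measurableSet_Ioi fun u (hu : 0 < u) => ?_
  exact semigroup_transProb N μ c hr.1.le (add_nonneg hs.1.le hu.le) 0

end Semigroup

/-! ### Spectral form of the return probabilities -/

section Return

variable {N : ℕ} [NeZero N] {μ : ℝ} {c ρ : ℕ → ℝ}

omit [NeZero N] in
lemma stepProb_eq_ofReal (hj : ∀ j, jumpProb N μ c (j + 1) = ρ j) (x y : HierGroup N) :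
    stepProb N μ c x y = ENNReal.ofReal (jumpLaw N ρ (y - x)) := by
  unfold stepProb jumpLaw
  by_cases h : x = y
  · simp [h]
  · have h' : y - x ≠ 0 := sub_ne_zero.2 (Ne.symm h)
    have h0 : hierNorm (y - x) ≠ 0 := fun h0 => h' (hierNorm_eq_zero_iff.1 h0)
    obtain ⟨k, hk⟩ := Nat.exists_eq_succ_of_ne_zero h0
    rw [if_neg h, if_neg h', hk, Nat.succ_eq_add_one, hj, Nat.add_sub_cancel]

lemma nStepProb_eq_ofReal (hN : 2 ≤ N) (hρ : ∀ i, 0 ≤ ρ i) (hρ1 : HasSum ρ 1)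
    (hj : ∀ j, jumpProb N μ c (j + 1) = ρ j) (n : ℕ) (y : HierGroup N) :
    nStepProb N μ c n 0 y = ENNReal.ofReal (spectralProb N ρ n y) := by
  induction n generalizing y with
  | zero =>
    rw [spectralProb_zero hN, nStepProb]
    split_ifs <;> simp
  | succ n ih =>
    have h := hasSum_spectralProb_succ hN hρ hρ1 n y
    rw [nStepProb, ← h.tsum_eq, ENNReal.ofReal_tsum_of_nonneg (fun z =>
      mul_nonneg (spectralProb_nonneg hN hρ hρ1 n z) (jumpLaw_nonneg hN hρ _)) h.summable]
    refine tsum_congr fun z => ?_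
    rw [ih, stepProb_eq_ofReal hj, ENNReal.ofReal_mul (spectralProb_nonneg hN hρ hρ1 n z)]

lemma transProb_origin (hN : 2 ≤ N) (hρ : ∀ i, 0 ≤ ρ i) (hρ1 : HasSum ρ 1)
    (hj : ∀ j, jumpProb N μ c (j + 1) = ρ j) {t : ℝ} (ht : 0 ≤ t) :
    transProb N μ c t 0 0 = ∑' k : ℕ, ENNReal.ofReal (((N : ℝ) - 1) / N * ((N : ℝ)⁻¹) ^ k) *
      ENNReal.ofReal (Real.exp (-((1 - eigenvalue N ρ k) * t))) := by
  have h := hasSum_exp_spectralProb_origin hN hρ hρ1 ht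
  have h1 : ∀ n : ℕ, ENNReal.ofReal (t ^ n / (n.factorial : ℝ)) * nStepProb N μ c n 0 0 =
      ENNReal.ofReal (t ^ n / (n.factorial : ℝ) * spectralProb N ρ n 0) := fun n => by
    rw [nStepProb_eq_ofReal hN hρ hρ1 hj, ENNReal.ofReal_mul (by positivity)]
  have h2 : Summable fun k : ℕ => ((N : ℝ) - 1) / N * ((N : ℝ)⁻¹) ^ k *
      Real.exp (t * eigenvalue N ρ k) := by
    refine Summable.of_norm_bounded ((summable_weight hN).mul_right (Real.exp t)) fun k => ?_
    rw [Real.norm_eq_abs, abs_mul, abs_of_nonneg (weight_nonneg hN k), Real.abs_exp]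
    refine mul_le_mul_of_nonneg_left (Real.exp_le_exp.2 ?_) (weight_nonneg hN k)
    exact mul_le_of_le_one_right ht (abs_le.1 (abs_eigenvalue_le_one hN hρ hρ1 k)).2
  unfold transProb
  simp only [h1]
  rw [← ENNReal.ofReal_tsum_of_nonneg (fun n => mul_nonneg (by positivity)
    (spectralProb_nonneg hN hρ hρ1 n 0)) h.summable, h.tsum_eq,
    ENNReal.ofReal_tsum_of_nonneg (fun k => mul_nonneg (weight_nonneg hN k)
      (Real.exp_nonneg _)) h2, ← ENNReal.tsum_mul_left]
  refine tsum_congr fun k => ?_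
  rw [← ENNReal.ofReal_mul (Real.exp_nonneg _), ← ENNReal.ofReal_mul (weight_nonneg hN k),
    mul_left_comm, ← Real.exp_add]
  congr 4
  ring

end Return

end HierarchicalWalk

namespace HierarchicalWalk

open MeasureTheory Filter

/-! ### Asymptotics of smoothly truncated sums -/

section Truncation

variable {b μ ν C D : ℝ} {δ : ℕ → ℝ} {F : ℝ → ℝ}

/-- The factor `δ k ^ ν` from the bound on `F` is absorbed by `δ k ^ (-μ)`, and `ν ≤ μ` with
monotonicity bounds what remains by its value at `0`. No upper bound on the growth of `δ` is
required. -/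
lemma truncated_term_le (hb : 1 < b) (hD : 0 < D) (hδ0 : 0 < δ 0) (hδ : Monotone δ)
    (hνμ : ν ≤ μ) (hC : 0 ≤ C) (hFC : ∀ x, 0 < x → F x ≤ C * x ^ ν) {t : ℝ} (ht : 0 < t) (k : ℕ) :
    1 / δ k ^ μ * F (D * δ k / b ^ k * t) ≤
      C * D ^ ν * (1 / δ 0 ^ (μ - ν)) * (t / b ^ k) ^ ν := by
  have hk : 0 < δ k := hδ0.trans_le (hδ (Nat.zero_le k))
  have hbk : 0 < b ^ k := by positivity
  have h1 := hFC (D * δ k / b ^ k * t) (by positivity)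
  calc 1 / δ k ^ μ * F (D * δ k / b ^ k * t)
      ≤ 1 / δ k ^ μ * (C * (D * δ k / b ^ k * t) ^ ν) := by gcongr
    _ = C * D ^ ν * (1 / δ k ^ (μ - ν)) * (t / b ^ k) ^ ν := by
        rw [show D * δ k / b ^ k * t = D * δ k * (t / b ^ k) by ring,
          Real.mul_rpow (by positivity) (by positivity), Real.mul_rpow hD.le hk.le,
          Real.rpow_sub hk]
        have : δ k ^ ν ≠ 0 := (Real.rpow_pos_of_pos hk _).ne'
        have : δ k ^ μ ≠ 0 := (Real.rpow_pos_of_pos hk _).ne'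
        field_simp
    _ ≤ C * D ^ ν * (1 / δ 0 ^ (μ - ν)) * (t / b ^ k) ^ ν := by
        have h2 : δ 0 ^ (μ - ν) ≤ δ k ^ (μ - ν) :=
          Real.rpow_le_rpow hδ0.le (hδ (Nat.zero_le k)) (by linarith)
        have h3 : 0 < δ 0 ^ (μ - ν) := Real.rpow_pos_of_pos hδ0 _
        gcongr

lemma div_pow_rpow (hb : 1 < b) {t : ℝ} (ht : 0 < t) (ν : ℝ) (k : ℕ) :
    (t / b ^ k) ^ ν = t ^ ν * (b ^ (-ν)) ^ k := by
  have hb0 : 0 < b := by linarith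
  rw [Real.div_rpow ht.le (by positivity), div_eq_mul_inv, ← Real.rpow_natCast b k,
    ← Real.rpow_natCast (b ^ (-ν)) k, ← Real.rpow_mul hb0.le, ← Real.rpow_mul hb0.le,
    ← Real.rpow_neg hb0.le]
  congr 2
  ring

lemma summable_truncated (hb : 1 < b) (hD : 0 < D) (hδ0 : 0 < δ 0) (hδ : Monotone δ)
    (hν : 0 < ν) (hνμ : ν ≤ μ) (hC : 0 ≤ C) (hF0 : ∀ x, 0 < x → 0 ≤ F x)
    (hFC : ∀ x, 0 < x → F x ≤ C * x ^ ν) {t : ℝ} (ht : 0 < t) :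
    Summable fun k => 1 / δ k ^ μ * F (D * δ k / b ^ k * t) := by
  have hb0 : 0 < b := by linarith
  have hq : b ^ (-ν) < 1 := Real.rpow_lt_one_of_one_lt_of_neg hb (by linarith)
  have hg := ((summable_geometric_of_lt_one (Real.rpow_nonneg hb0.le _) hq).mul_left
    (t ^ ν)).mul_left (C * D ^ ν * (1 / δ 0 ^ (μ - ν)))
  refine hg.of_nonneg_of_le (fun k => ?_) fun k => ?_
  · have hk : 0 < δ k := hδ0.trans_le (hδ (Nat.zero_le k))
    exact mul_nonneg (by positivity) (hF0 _ (by positivity))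
  · rw [← div_pow_rpow hb ht]
    exact truncated_term_le hb hD hδ0 hδ hνμ hC hFC ht k

/-- `F ≤ 1` handles `k < n`; past `n`, `t / b^n ≤ 1` makes the tail geometric with a bound
independent of `t`. -/
lemma tsum_truncated_le (hb : 1 < b) (hD : 0 < D) (hδ0 : 0 < δ 0) (hδ : Monotone δ)
    (hν : 0 < ν) (hνμ : ν ≤ μ) (hC : 0 ≤ C) (hF0 : ∀ x, 0 < x → 0 ≤ F x)
    (hF1 : ∀ x, 0 < x → F x ≤ 1) (hFC : ∀ x, 0 < x → F x ≤ C * x ^ ν) {t : ℝ} (ht : 0 < t)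
    {n : ℕ} (hn : t ≤ b ^ n) :
    ∑' k, 1 / δ k ^ μ * F (D * δ k / b ^ k * t) ≤
      ∑ k ∈ Finset.range n, 1 / δ k ^ μ +
        C * D ^ ν * (1 / δ 0 ^ (μ - ν)) * (1 - b ^ (-ν))⁻¹ := by
  have hb0 : 0 < b := by linarith
  have hq0 : 0 ≤ b ^ (-ν) := Real.rpow_nonneg hb0.le _
  have hq : b ^ (-ν) < 1 := Real.rpow_lt_one_of_one_lt_of_neg hb (by linarith)
  have hs := summable_truncated hb hD hδ0 hδ hν hνμ hC hF0 hFC ht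
  rw [← hs.sum_add_tsum_nat_add n]
  refine add_le_add (Finset.sum_le_sum fun k _ => ?_) ?_
  · have hk : 0 < δ k := hδ0.trans_le (hδ (Nat.zero_le k))
    exact mul_le_of_le_one_right (by positivity) (hF1 _ (by positivity))
  · rw [← tsum_geometric_of_lt_one hq0 hq, ← tsum_mul_left]
    refine ((summable_nat_add_iff n).2 hs).tsum_le_tsum (fun k => ?_)
      ((summable_geometric_of_lt_one hq0 hq).mul_left _)
    refine (truncated_term_le hb hD hδ0 hδ hνμ hC hFC ht (k + n)).trans ?_
    have h1 : (t / b ^ (k + n)) ^ ν ≤ (b ^ (-ν)) ^ k := by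
      rw [div_pow_rpow hb ht, pow_add, mul_left_comm, ← div_pow_rpow hb ht]
      refine mul_le_of_le_one_right (by positivity) (Real.rpow_le_one (by positivity) ?_ hν.le)
      exact (div_le_one (by positivity)).2 hn
    gcongr

/-- For `k < n - m` the argument of `F` is at least `D * δ 0 * b ^ m ≥ X`. The at most `m` terms
skipped below `n` each cost at most `1 / δ 0 ^ μ`. -/
lemma le_tsum_truncated (hb : 1 < b) (hD : 0 < D) (hδ0 : 0 < δ 0) (hδ : Monotone δ)
    (hμ : 0 < μ) (hF0 : ∀ x, 0 < x → 0 ≤ F x) {t : ℝ} (ht : 0 < t)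
    (hs : Summable fun k => 1 / δ k ^ μ * F (D * δ k / b ^ k * t))
    {ε X : ℝ} (hε : 0 < ε) (hX : ∀ x, X ≤ x → 1 - ε ≤ F x) {m n : ℕ}
    (hm : X ≤ D * δ 0 * b ^ m) (hn : b ^ n ≤ b * t) :
    ∑ k ∈ Finset.range n, 1 / δ k ^ μ - ε * ∑ k ∈ Finset.range n, 1 / δ k ^ μ -
      m * (1 / δ 0 ^ μ) ≤ ∑' k, 1 / δ k ^ μ * F (D * δ k / b ^ k * t) := by
  have hb0 : 0 < b := by linarith
  have hk : ∀ k, 0 < δ k := fun k => hδ0.trans_le (hδ (Nat.zero_le k))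
  have hS : ∑ k ∈ Finset.range n, 1 / δ k ^ μ ≤
      ∑ k ∈ Finset.range (n - m), 1 / δ k ^ μ + m * (1 / δ 0 ^ μ) := by
    rw [← Finset.sum_range_add_sum_Ico _ (Nat.sub_le n m)]
    refine add_le_add le_rfl ?_
    have h1 : ∀ k ∈ Finset.Ico (n - m) n, 1 / δ k ^ μ ≤ 1 / δ 0 ^ μ := fun k _ =>
      one_div_le_one_div_of_le (Real.rpow_pos_of_pos hδ0 _)
        (Real.rpow_le_rpow hδ0.le (hδ (Nat.zero_le k)) hμ.le)
    refine (Finset.sum_le_card_nsmul _ _ _ h1).trans ?_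
    rw [nsmul_eq_mul, Nat.card_Ico]
    have h2 : ((n - (n - m) : ℕ) : ℝ) ≤ m := by
      exact_mod_cast (by omega : n - (n - m) ≤ m)
    have h3 : 0 ≤ 1 / δ 0 ^ μ := by positivity
    gcongr
  have hS0 : 0 ≤ ∑ k ∈ Finset.range (n - m), 1 / δ k ^ μ :=
    Finset.sum_nonneg fun k _ => div_nonneg zero_le_one (Real.rpow_nonneg (hk k).le _)
  have hSn : ∑ k ∈ Finset.range (n - m), 1 / δ k ^ μ ≤ ∑ k ∈ Finset.range n, 1 / δ k ^ μ :=
    Finset.sum_le_sum_of_subset_of_nonneg (Finset.range_mono (Nat.sub_le n m)) fun k _ _ =>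
      div_nonneg zero_le_one (Real.rpow_nonneg (hk k).le _)
  have hmain : ∑ k ∈ Finset.range (n - m), 1 / δ k ^ μ * (1 - ε) ≤
      ∑' k, 1 / δ k ^ μ * F (D * δ k / b ^ k * t) := by
    refine le_trans (Finset.sum_le_sum fun k hkn => ?_)
      (hs.sum_le_tsum (Finset.range (n - m)) fun k _ => ?_)
    · rw [Finset.mem_range] at hkn
      have h0 := hk k
      refine mul_le_mul_of_nonneg_left (hX _ (hm.trans ?_)) (by positivity)
      -- From `m + k + 1 ≤ n` and `b ^ n ≤ b * t`, cancelling one factor `b`.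
      have h4 : b ^ m * b ^ k ≤ t := by
        have h5 : b ^ (m + k + 1) ≤ b * t :=
          (pow_le_pow_right₀ hb.le (by omega)).trans hn
        rw [pow_succ, pow_add, mul_comm _ b] at h5
        exact le_of_mul_le_mul_left h5 hb0
      rw [show D * δ k / b ^ k * t = D * δ k * (t / b ^ k) by ring]
      have h6 : b ^ m ≤ t / b ^ k := (le_div_iff₀ (by positivity)).2 h4
      have h7 : δ 0 ≤ δ k := hδ (Nat.zero_le k)
      gcongr
    · have h0 := hk k
      exact mul_nonneg (by positivity) (hF0 _ (by positivity))
  rw [← Finset.sum_mul] at hmain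
  nlinarith

/-- A sum of the terms `δ k ^ (-μ)` with a smooth cutoff at `k ≈ log t / log b` is asymptotically
equivalent to the sharply truncated sum. -/
lemma isEquivalent_tsum_truncated (hb : 1 < b) (hD : 0 < D) (hδ0 : 0 < δ 0) (hδ : Monotone δ)
    (hμ : 0 < μ) (hdiv : ¬ Summable fun k => 1 / δ k ^ μ)
    (hν : 0 < ν) (hνμ : ν ≤ μ) (hC : 0 ≤ C) (hF0 : ∀ x, 0 < x → 0 ≤ F x)
    (hF1 : ∀ x, 0 < x → F x ≤ 1) (hFC : ∀ x, 0 < x → F x ≤ C * x ^ ν)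
    (hFlim : Tendsto F atTop (nhds 1)) {n : ℝ → ℕ}
    (hn : ∀ t, 1 ≤ t → t ≤ b ^ n t ∧ b ^ n t ≤ b * t) :
    (fun t => ∑' k, 1 / δ k ^ μ * F (D * δ k / b ^ k * t)) ~[atTop]
      fun t => ∑ k ∈ Finset.range (n t), 1 / δ k ^ μ := by
  have hk : ∀ k, 0 < δ k := fun k => hδ0.trans_le (hδ (Nat.zero_le k))
  have hnn : ∀ k, 0 ≤ 1 / δ k ^ μ := fun k =>
    div_nonneg zero_le_one (Real.rpow_nonneg (hk k).le _)
  have hntop : Tendsto n atTop atTop := by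
    rw [tendsto_atTop]
    intro k
    filter_upwards [eventually_gt_atTop (b ^ k), eventually_ge_atTop 1] with t ht ht1
    exact ((pow_lt_pow_iff_right₀ hb).1 (ht.trans_le (hn t ht1).1)).le
  have hStop : Tendsto (fun t => ∑ k ∈ Finset.range (n t), 1 / δ k ^ μ) atTop atTop :=
    ((not_summable_iff_tendsto_nat_atTop_of_nonneg hnn).1 hdiv).comp hntop
  rw [Asymptotics.IsEquivalent, Asymptotics.isLittleO_iff]
  intro ε' hε'
  -- The lower bound has two errors, from `F < 1` and from the `m` skipped terms; each receives
  -- half.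
  have hε : 0 < ε' / 2 := half_pos hε'
  obtain ⟨X, hX⟩ := eventually_atTop.1
    (hFlim.eventually (eventually_ge_nhds (show 1 - ε' / 2 < 1 by linarith)))
  obtain ⟨m, hm⟩ : ∃ m : ℕ, X ≤ D * δ 0 * b ^ m :=
    ((tendsto_pow_atTop_atTop_of_one_lt hb).const_mul_atTop (mul_pos hD hδ0)
      |>.eventually_ge_atTop X).exists
  filter_upwards [eventually_ge_atTop 1,
    hStop.eventually_ge_atTop (C * D ^ ν * (1 / δ 0 ^ (μ - ν)) * (1 - b ^ (-ν))⁻¹ / ε'),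
    hStop.eventually_ge_atTop (m * (1 / δ 0 ^ μ) / (ε' / 2)),
    hStop.eventually_ge_atTop 0] with t ht1 h1 h2 h3
  have ht : 0 < t := by linarith
  have hs := summable_truncated hb hD hδ0 hδ hν hνμ hC hF0 hFC ht
  have hup := tsum_truncated_le hb hD hδ0 hδ hν hνμ hC hF0 hF1 hFC ht (hn t ht1).1
  have hlo := le_tsum_truncated hb hD hδ0 hδ hμ hF0 ht hs hε hX hm (hn t ht1).2
  rw [div_le_iff₀ hε'] at h1
  rw [div_le_iff₀ hε] at h2
  simp only [Pi.sub_apply, Real.norm_eq_abs]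
  rw [abs_of_nonneg h3, abs_le]
  constructor <;> linarith

end Truncation

end HierarchicalWalk

namespace HierarchicalWalk

open MeasureTheory Filter

/-! ### Laplace kernels -/

section Kernel

lemma lintegral_Ioc_exp_neg_mul {a t : ℝ} (ha : 0 < a) (ht : 0 < t) :
    ∫⁻ s in Set.Ioc 0 t, ENNReal.ofReal (Real.exp (-(a * s))) =
      ENNReal.ofReal ((1 - Real.exp (-(a * t))) / a) := by
  have hint : IntervalIntegrable (fun s => Real.exp (-(a * s))) volume 0 t :=
    Continuous.intervalIntegrable (by fun_prop) _ _
  rw [← ofReal_integral_eq_lintegral_ofReal hint.1 (ae_of_all _ fun s => Real.exp_nonneg _),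
    ← intervalIntegral.integral_of_le ht.le,
    intervalIntegral.integral_eq_sub_of_hasDerivAt (f := fun s => -Real.exp (-(a * s)) / a)
      (fun s _ => ?_) hint]
  · congr 1
    simp
    ring
  · have h1 : HasDerivAt (fun s => -(a * s)) (-a) s := by
      have h2 := ((hasDerivAt_id s).const_mul a).neg
      rw [mul_one] at h2
      exact h2
    exact (h1.exp.neg.div_const a).congr_deriv (by field_simp)

lemma lintegral_Ioi_exp_neg_mul {a : ℝ} (ha : 0 < a) :
    ∫⁻ s in Set.Ioi 0, ENNReal.ofReal (Real.exp (-(a * s))) = ENNReal.ofReal (1 / a) := by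
  have h := integral_exp_mul_Ioi (neg_lt_zero.2 ha) 0
  have h1 := exp_neg_integrableOn_Ioi 0 ha
  simp only [neg_mul] at h h1
  rw [← ofReal_integral_eq_lintegral_ofReal h1 (ae_of_all _ fun s => Real.exp_nonneg _), h]
  simp

/-- The normalized lower incomplete gamma function. -/
noncomputable def gammaCdf (μ x : ℝ) : ℝ :=
  1 / Real.Gamma μ * ∫ u in (0 : ℝ)..x, Real.exp (-u) * u ^ (μ - 1)

variable {μ : ℝ}

lemma intervalIntegrable_gamma (hμ : 0 < μ) (x : ℝ) :
    IntervalIntegrable (fun u => Real.exp (-u) * u ^ (μ - 1)) volume 0 x :=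
  (intervalIntegral.intervalIntegrable_rpow' (by linarith)).continuousOn_mul
    (by fun_prop)

lemma gammaCdf_nonneg (hμ : 0 < μ) {x : ℝ} (hx : 0 < x) : 0 ≤ gammaCdf μ x := by
  have := Real.Gamma_pos_of_pos hμ
  refine mul_nonneg (by positivity) (intervalIntegral.integral_nonneg hx.le fun u hu => ?_)
  have := hu.1
  positivity

lemma gammaCdf_le_one (hμ : 0 < μ) {x : ℝ} (hx : 0 < x) : gammaCdf μ x ≤ 1 := by
  have h0 := Real.Gamma_pos_of_pos hμ
  unfold gammaCdf
  rw [one_div_mul_eq_div, div_le_one h0, Real.Gamma_eq_integral hμ,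
    intervalIntegral.integral_of_le hx.le]
  refine setIntegral_mono_set (Real.GammaIntegral_convergent hμ) ?_
    Set.Ioc_subset_Ioi_self.eventuallyLE
  filter_upwards [ae_restrict_mem measurableSet_Ioi] with u (hu : 0 < u)
  simp only [Pi.zero_apply]
  positivity

/-- Dropping the exponential from the integrand gives the small-argument bound with `ν = μ`. -/
lemma gammaCdf_le (hμ : 0 < μ) {x : ℝ} (hx : 0 < x) :
    gammaCdf μ x ≤ 1 / Real.Gamma μ * (1 / μ) * x ^ μ := by
  have h0 := Real.Gamma_pos_of_pos hμ
  have h1 : ∫ u in (0 : ℝ)..x, u ^ (μ - 1) = 1 / μ * x ^ μ := by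
    rw [integral_rpow (Or.inl (by linarith))]
    simp [Real.zero_rpow hμ.ne', div_eq_inv_mul]
  unfold gammaCdf
  rw [mul_assoc, ← h1]
  refine mul_le_mul_of_nonneg_left ?_ (by positivity)
  refine intervalIntegral.integral_mono_on hx.le (intervalIntegrable_gamma hμ x)
    (intervalIntegral.intervalIntegrable_rpow' (by linarith)) fun u hu => ?_
  exact mul_le_of_le_one_left (Real.rpow_nonneg hu.1 _) (Real.exp_le_one_iff.2 (by linarith [hu.1]))

lemma tendsto_gammaCdf (hμ : 0 < μ) : Tendsto (gammaCdf μ) atTop (nhds 1) := by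
  have h0 := Real.Gamma_pos_of_pos hμ
  have h := (intervalIntegral_tendsto_integral_Ioi 0 (Real.GammaIntegral_convergent hμ)
    tendsto_id).const_mul (1 / Real.Gamma μ)
  rw [← Real.Gamma_eq_integral hμ, one_div_mul_cancel h0.ne'] at h
  exact h

lemma lintegral_rpow_mul_exp_neg_mul (hμ : 0 < μ) {a t : ℝ} (ha : 0 < a) (ht : 0 < t) :
    ENNReal.ofReal (1 / Real.Gamma μ) * ∫⁻ s in Set.Ioc 0 t,
      ENNReal.ofReal (s ^ (μ - 1)) * ENNReal.ofReal (Real.exp (-(a * s))) =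
      ENNReal.ofReal (a ^ (-μ) * gammaCdf μ (a * t)) := by
  have h0 := Real.Gamma_pos_of_pos hμ
  have hint : IntervalIntegrable (fun s => Real.exp (-(a * s)) * s ^ (μ - 1)) volume 0 t :=
    (intervalIntegral.intervalIntegrable_rpow' (by linarith)).continuousOn_mul (by fun_prop)
  have h1 : ∫⁻ s in Set.Ioc 0 t,
      ENNReal.ofReal (s ^ (μ - 1)) * ENNReal.ofReal (Real.exp (-(a * s))) =
      ENNReal.ofReal (∫ s in (0 : ℝ)..t, Real.exp (-(a * s)) * s ^ (μ - 1)) := by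
    rw [intervalIntegral.integral_of_le ht.le, ofReal_integral_eq_lintegral_ofReal hint.1 ?_]
    · refine setLIntegral_congr_fun measurableSet_Ioc fun s hs => ?_
      rw [← ENNReal.ofReal_mul (Real.rpow_nonneg hs.1.le _), mul_comm]
    · filter_upwards [ae_restrict_mem measurableSet_Ioc] with s hs
      exact mul_nonneg (Real.exp_nonneg _) (Real.rpow_nonneg hs.1.le _)
  have h2 : ∫ s in (0 : ℝ)..t, Real.exp (-(a * s)) * s ^ (μ - 1) =
      a ^ (-μ) * ∫ u in (0 : ℝ)..a * t, Real.exp (-u) * u ^ (μ - 1) := by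
    have h3 := intervalIntegral.integral_comp_mul_left (a := 0) (b := t)
      (fun u => Real.exp (-u) * u ^ (μ - 1)) ha.ne'
    rw [mul_zero, smul_eq_mul] at h3
    -- Under `u = a * s`, the Jacobian contributes `a⁻¹` and the power of the integrand `a ^ (1 -
    -- μ)`.
    have h4 : a ^ (-μ) = a ^ (1 - μ) * a⁻¹ := by
      rw [← Real.rpow_neg_one a, ← Real.rpow_add ha]
      congr 1
      ring
    rw [h4, mul_assoc, ← h3, ← intervalIntegral.integral_const_mul]
    refine intervalIntegral.integral_congr fun s hs => ?_
    rw [Set.uIcc_of_le ht.le] at hs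
    rw [Real.mul_rpow ha.le hs.1, mul_left_comm, ← mul_assoc (a ^ (1 - μ)), ← Real.rpow_add ha,
      show 1 - μ + (μ - 1) = 0 by ring, Real.rpow_zero, one_mul]
  rw [h1, h2, ← ENNReal.ofReal_mul (by positivity)]
  congr 1
  unfold gammaCdf
  ring

lemma one_sub_exp_neg_mem {x : ℝ} (hx : 0 < x) :
    0 ≤ 1 - Real.exp (-x) ∧ 1 - Real.exp (-x) ≤ 1 ∧ 1 - Real.exp (-x) ≤ x := by
  have h1 : Real.exp (-x) ≤ 1 := Real.exp_le_one_iff.2 (by linarith)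
  have h2 := Real.exp_pos (-x)
  have h3 := Real.add_one_le_exp (-x)
  refine ⟨?_, ?_, ?_⟩ <;> linarith

lemma tendsto_sq_one_sub_exp_neg :
    Tendsto (fun x : ℝ => (1 - Real.exp (-x)) ^ 2) atTop (nhds 1) := by
  have h := (Real.tendsto_exp_neg_atTop_nhds_zero.const_sub 1).pow 2
  simpa using h

end Kernel

/-! ### The parameters of the walk -/

section Parameters

variable {N : ℕ} {μ : ℝ} {c : ℕ → ℝ}

lemma normConst_pos (hc : ∀ j, 0 < c j)
    (hsum : Summable fun j : ℕ => c j / (N : ℝ) ^ ((j : ℝ) / μ)) (hN : 2 ≤ N) :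
    0 < normConst N μ c := by
  have hN0 : (0 : ℝ) < N := by exact_mod_cast (by omega : 0 < N)
  have h : ∀ j : ℕ, 0 < c j / (N : ℝ) ^ ((j : ℝ) / μ) := fun j =>
    div_pos (hc j) (Real.rpow_pos_of_pos hN0 _)
  exact inv_pos.2 (hsum.tsum_pos (fun j => (h j).le) 0 (h 0))

lemma jumpProb_succ (j : ℕ) :
    jumpProb N μ c (j + 1) = normConst N μ c * (c j / (N : ℝ) ^ ((j : ℝ) / μ)) := by
  simp [jumpProb]

lemma hasSum_jumpProb (hc : ∀ j, 0 < c j)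
    (hsum : Summable fun j : ℕ => c j / (N : ℝ) ^ ((j : ℝ) / μ)) (hN : 2 ≤ N) :
    HasSum (fun j => jumpProb N μ c (j + 1)) 1 := by
  have h := hsum.hasSum.mul_left (normConst N μ c)
  have h0 := normConst_pos hc hsum hN
  simp only [jumpProb_succ]
  rwa [normConst, inv_mul_cancel₀ (inv_pos.1 h0).ne'] at h

lemma jumpProb_succ_nonneg (hc : ∀ j, 0 < c j)
    (hsum : Summable fun j : ℕ => c j / (N : ℝ) ^ ((j : ℝ) / μ)) (hN : 2 ≤ N) (j : ℕ) :
    0 ≤ jumpProb N μ c (j + 1) := by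
  have h0 := normConst_pos hc hsum hN
  have := hc j
  rw [jumpProb_succ]
  positivity

lemma one_lt_rpow_inv (hN : 2 ≤ N) (hμ : 0 < μ) : 1 < (N : ℝ) ^ (1 / μ) :=
  Real.one_lt_rpow (by exact_mod_cast (by omega : 1 < N)) (by positivity)

lemma rpow_div_eq_pow (k : ℕ) : (N : ℝ) ^ ((k : ℝ) / μ) = ((N : ℝ) ^ (1 / μ)) ^ k := by
  rw [← Real.rpow_natCast, ← Real.rpow_mul (Nat.cast_nonneg N)]
  congr 1
  ring

lemma dSeq_pos (hc : ∀ j, 0 < c j) (hN : 2 ≤ N) (j : ℕ) : 0 < dSeq N μ c j := by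
  have hN' : (2 : ℝ) ≤ N := by exact_mod_cast hN
  have h := hc j
  refine mul_pos h (add_pos_of_pos_of_nonneg (div_pos (by linarith) (by linarith))
    (mul_nonneg (by positivity) (tsum_nonneg fun k => ?_)))
  have := hc (j + 1 + k)
  positivity

/-- Since `ρ` has total mass one, the left side is `ρ k * N/(N-1)` plus the tail `∑_{i > k} ρ i`;
factoring out `D / b^k` leaves `dSeq`. -/
lemma one_sub_eigenvalue (hc : ∀ j, 0 < c j)
    (hsum : Summable fun j : ℕ => c j / (N : ℝ) ^ ((j : ℝ) / μ)) (hN : 2 ≤ N) (k : ℕ) :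
    1 - eigenvalue N (fun j => jumpProb N μ c (j + 1)) k =
      normConst N μ c * dSeq N μ c k / ((N : ℝ) ^ (1 / μ)) ^ k := by
  have hN' : (2 : ℝ) ≤ N := by exact_mod_cast hN
  have hN0 : (0 : ℝ) < N := by linarith
  have h1 := hasSum_jumpProb hc hsum hN
  set ρ : ℕ → ℝ := fun j => jumpProb N μ c (j + 1) with hρ
  have hbk : ((N : ℝ) ^ (1 / μ)) ^ k ≠ 0 := (pow_pos (Real.rpow_pos_of_pos hN0 _) k).ne'
  have h2 : 1 = ∑ i ∈ Finset.range (k + 1), ρ i + ∑' m, ρ (m + (k + 1)) := by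
    rw [h1.summable.sum_add_tsum_nat_add (k + 1), h1.tsum_eq]
  have h3 : ∑' m, ρ (m + (k + 1)) = normConst N μ c / ((N : ℝ) ^ (1 / μ)) ^ k *
      ∑' m : ℕ, c (k + 1 + m) / (N : ℝ) ^ (((m : ℝ) + 1) / μ) := by
    rw [← tsum_mul_left]
    refine tsum_congr fun m => ?_
    have h4 : (N : ℝ) ^ (((m + (k + 1) : ℕ) : ℝ) / μ) =
        ((N : ℝ) ^ (1 / μ)) ^ k * (N : ℝ) ^ (((m : ℝ) + 1) / μ) := by
      rw [← rpow_div_eq_pow, ← Real.rpow_add hN0]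
      congr 1
      push_cast
      ring
    simp only [hρ]
    rw [jumpProb_succ, h4, show m + (k + 1) = k + 1 + m by ring, mul_comm_div, div_div]
    ring
  have h5 : ρ k = normConst N μ c * (c k / ((N : ℝ) ^ (1 / μ)) ^ k) := by
    simp only [hρ]
    rw [jumpProb_succ, rpow_div_eq_pow]
  have h6 : (N : ℝ) - 1 ≠ 0 := by linarith
  have h7 := (hc k).ne'
  rw [Finset.sum_range_succ, h3] at h2
  unfold eigenvalue dSeq
  set T := ∑' m : ℕ, c (k + 1 + m) / (N : ℝ) ^ (((m : ℝ) + 1) / μ)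
  rw [show c k * ((N : ℝ) / ((N : ℝ) - 1) + 1 / c k * T) = c k * (N : ℝ) / ((N : ℝ) - 1) + T by
    field_simp]
  have h8 : 1 - ∑ i ∈ Finset.range k, ρ i =
      ρ k + normConst N μ c / ((N : ℝ) ^ (1 / μ)) ^ k * T := by linarith
  rw [← sub_add, h8, h5]
  field_simp
  ring

/-- With `b = N^(1/μ)`, `t = b^x` for `x = μ log t / log N`, and `x < ⌊x⌋ + 1 ≤ x + 1`. -/
lemma floor_log_bounds (hN : 2 ≤ N) (hμ : 0 < μ) (t : ℝ) (ht : 1 ≤ t) :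
    t ≤ ((N : ℝ) ^ (1 / μ)) ^ (⌊μ * Real.log t / Real.log (N : ℝ)⌋₊ + 1) ∧
      ((N : ℝ) ^ (1 / μ)) ^ (⌊μ * Real.log t / Real.log (N : ℝ)⌋₊ + 1) ≤
        (N : ℝ) ^ (1 / μ) * t := by
  have hN' : (2 : ℝ) ≤ N := by exact_mod_cast hN
  have hN0 : (0 : ℝ) < N := by linarith
  have hlog : 0 < Real.log N := Real.log_pos (by linarith)
  have hb := one_lt_rpow_inv hN hμ
  set b := (N : ℝ) ^ (1 / μ) with hb_def
  set x := μ * Real.log t / Real.log (N : ℝ) with hx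
  have hx0 : 0 ≤ x := div_nonneg (mul_nonneg hμ.le (Real.log_nonneg ht)) hlog.le
  have htx : t = b ^ x := by
    rw [hb_def, ← Real.rpow_mul hN0.le, Real.rpow_def_of_pos hN0, hx]
    rw [show Real.log N * (1 / μ * (μ * Real.log t / Real.log N)) = Real.log t by field_simp,
      Real.exp_log (by linarith)]
  constructor
  · conv_lhs => rw [htx]
    rw [← Real.rpow_natCast]
    refine Real.rpow_le_rpow_of_exponent_le hb.le ?_
    push_cast
    exact (Nat.lt_floor_add_one x).le
  · rw [pow_succ, mul_comm]
    refine mul_le_mul_of_nonneg_left ?_ (by linarith)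
    conv_rhs => rw [htx]
    rw [← Real.rpow_natCast]
    exact Real.rpow_le_rpow_of_exponent_le hb.le (Nat.floor_le hx0)

/-- Asymptotics of a functional of the walk which acts on the spectral components by
`a ^ (-μ) * F (a * t)`. -/
lemma finite_and_isEquivalent_growth (hN : 2 ≤ N) (hμ : 0 < μ) (hc : ∀ j, 0 < c j)
    (hsum : Summable fun j : ℕ => c j / (N : ℝ) ^ ((j : ℝ) / μ))
    (hmono : ∀ j, dSeq N μ c j ≤ dSeq N μ c (j + 1))
    (hdiv : ¬ Summable fun j : ℕ => 1 / dSeq N μ c j ^ μ)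
    {ν C : ℝ} {F : ℝ → ℝ} (hν : 0 < ν) (hνμ : ν ≤ μ) (hC : 0 ≤ C) (hF0 : ∀ x, 0 < x → 0 ≤ F x)
    (hF1 : ∀ x, 0 < x → F x ≤ 1) (hFC : ∀ x, 0 < x → F x ≤ C * x ^ ν)
    (hFlim : Tendsto F atTop (nhds 1)) {H : ℝ → ℝ≥0∞}
    -- The rates are left arbitrary, so a functional can be computed from the exponential mixture
    -- alone, without the parameters of the walk.
    (hH : ∀ t, 0 < t → ∀ a : ℕ → ℝ, (∀ k, 0 < a k) →
      (∀ s, 0 ≤ s → transProb N μ c s 0 0 =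
        ∑' k : ℕ, ENNReal.ofReal (((N : ℝ) - 1) / N * ((N : ℝ)⁻¹) ^ k) *
          ENNReal.ofReal (Real.exp (-(a k * s)))) →
      H t = ∑' k : ℕ, ENNReal.ofReal (((N : ℝ) - 1) / N * ((N : ℝ)⁻¹) ^ k) *
        ENNReal.ofReal (a k ^ (-μ) * F (a k * t))) :
    (∀ t, 0 < t → H t < ⊤) ∧ (fun t => (H t).toReal) ~[atTop] growth N μ c := by
  have hN' : (2 : ℝ) ≤ N := by exact_mod_cast hN
  have hN0 : (0 : ℝ) < N := by linarith
  have : NeZero N := ⟨by omega⟩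
  have hD := normConst_pos hc hsum hN
  have hd := dSeq_pos (μ := μ) hc hN
  have hb := one_lt_rpow_inv hN hμ
  have hδ : Monotone (dSeq N μ c) := monotone_nat_of_le_succ hmono
  have hs := fun t ht => summable_truncated (t := t) hb hD (hd 0) hδ hν hνμ hC hF0 hFC ht
  have hmain := isEquivalent_tsum_truncated hb hD (hd 0) hδ hμ hdiv hν hνμ hC hF0 hF1 hFC hFlim
    (floor_log_bounds hN hμ)
  have hgrowth : growth N μ c = fun t => ((N : ℝ) - 1) / ((N : ℝ) * normConst N μ c ^ μ) *
      ∑ j ∈ Finset.range (⌊μ * Real.log t / Real.log (N : ℝ)⌋₊ + 1),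
        1 / dSeq N μ c j ^ μ := rfl
  rw [hgrowth]
  set D := normConst N μ c
  set d := dSeq N μ c
  set b := (N : ℝ) ^ (1 / μ) with hb_def
  have hb0 : 0 < b := by linarith
  have ha : ∀ k, 0 < D * d k / b ^ k := fun k => by
    have := hd k
    positivity
  have hA : 0 ≤ ((N : ℝ) - 1) / ((N : ℝ) * D ^ μ) :=
    div_nonneg (by linarith) (by positivity)
  have hterm : ∀ k t, ((N : ℝ) - 1) / N * ((N : ℝ)⁻¹) ^ k *
      ((D * d k / b ^ k) ^ (-μ) * F (D * d k / b ^ k * t)) =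
      ((N : ℝ) - 1) / ((N : ℝ) * D ^ μ) * (1 / d k ^ μ * F (D * d k / b ^ k * t)) := by
    intro k t
    have hk := hd k
    -- This cancels the weight `N^(-k)`, leaving the bare term `1 / d k ^ μ`.
    have hbN : (b ^ k) ^ μ = (N : ℝ) ^ k := by
      rw [hb_def, ← Real.rpow_natCast, ← Real.rpow_natCast, ← Real.rpow_mul hN0.le,
        ← Real.rpow_mul hN0.le]
      congr 1
      field_simp
    rw [Real.rpow_neg (ha k).le, Real.div_rpow (by positivity) (by positivity), hbN,
      Real.mul_rpow hD.le hk.le, inv_pow]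
    have h1 : D ^ μ ≠ 0 := (Real.rpow_pos_of_pos hD _).ne'
    have h2 : d k ^ μ ≠ 0 := (Real.rpow_pos_of_pos hk _).ne'
    field_simp
  have hHt : ∀ t, 0 < t → H t = ENNReal.ofReal (((N : ℝ) - 1) / ((N : ℝ) * D ^ μ) *
      ∑' k, 1 / d k ^ μ * F (D * d k / b ^ k * t)) := by
    intro t ht
    rw [hH t ht (fun k => D * d k / b ^ k) ha, ← tsum_mul_left, ENNReal.ofReal_tsum_of_nonneg]
    · refine tsum_congr fun k => ?_
      rw [← ENNReal.ofReal_mul (weight_nonneg hN k), hterm]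
    · intro k
      have hk := hd k
      have hak := ha k
      exact mul_nonneg hA (mul_nonneg (by positivity) (hF0 _ (by positivity)))
    · exact (hs t ht).mul_left _
    · intro s hs0
      rw [transProb_origin hN (jumpProb_succ_nonneg hc hsum hN) (hasSum_jumpProb hc hsum hN)
        (fun _ => rfl) hs0]
      simp only [one_sub_eigenvalue hc hsum hN]
      rfl
  refine ⟨fun t ht => by rw [hHt t ht]; exact ENNReal.ofReal_lt_top, ?_⟩
  have hequiv := (Asymptotics.IsEquivalent.refl (u := fun _ : ℝ =>
    ((N : ℝ) - 1) / ((N : ℝ) * D ^ μ)) (l := atTop)).mul hmain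
  refine hequiv.congr_left ?_
  filter_upwards [eventually_gt_atTop 0] with t ht
  rw [hHt t ht, ENNReal.toReal_ofReal]
  · rfl
  · refine mul_nonneg hA (tsum_nonneg fun k => ?_)
    have hk := hd k
    have hak := ha k
    exact mul_nonneg (by positivity) (hF0 _ (by positivity))

end Parameters

end HierarchicalWalk

namespace HierarchicalWalk

open MeasureTheory Filter

/-! ### The functionals in spectral form -/

section Functionals

variable {N : ℕ} {μ : ℝ} {c : ℕ → ℝ} {w : ℕ → ℝ≥0∞} {a : ℕ → ℝ}

lemma gInc_eq_tsum (hμ : 0 < μ) (ha : ∀ k, 0 < a k)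
    (hp : ∀ s, 0 ≤ s → transProb N μ c s 0 0 =
      ∑' k, w k * ENNReal.ofReal (Real.exp (-(a k * s)))) {t : ℝ} (ht : 0 < t) :
    gInc N μ c μ t = ∑' k, w k * ENNReal.ofReal (a k ^ (-μ) * gammaCdf μ (a k * t)) := by
  have hm : ∀ k, Measurable fun s : ℝ =>
      ENNReal.ofReal (s ^ (μ - 1)) * ENNReal.ofReal (Real.exp (-(a k * s))) :=
    fun k => by fun_prop
  have h1 : ∫⁻ s in Set.Ioc 0 t, ENNReal.ofReal (s ^ (μ - 1)) * transProb N μ c s 0 0 =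
      ∫⁻ s in Set.Ioc 0 t, ∑' k, w k *
        (ENNReal.ofReal (s ^ (μ - 1)) * ENNReal.ofReal (Real.exp (-(a k * s)))) := by
    refine setLIntegral_congr_fun measurableSet_Ioc fun s hs => ?_
    rw [hp s hs.1.le, ← ENNReal.tsum_mul_left]
    exact tsum_congr fun k => mul_left_comm _ _ _
  unfold gInc
  rw [h1, lintegral_tsum fun k => ((hm k).const_mul _).aemeasurable, ← ENNReal.tsum_mul_left]
  refine tsum_congr fun k => ?_
  rw [lintegral_const_mul _ (hm k), mul_left_comm, lintegral_rpow_mul_exp_neg_mul hμ (ha k) ht]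

lemma lintegral_tsum_exp_neg_mul (S : Set ℝ) (v : ℕ → ℝ≥0∞) :
    ∫⁻ s in S, ∑' k, v k * ENNReal.ofReal (Real.exp (-(a k * s))) =
      ∑' k, v k * ∫⁻ s in S, ENNReal.ofReal (Real.exp (-(a k * s))) := by
  have hm : ∀ k, Measurable fun s : ℝ => ENNReal.ofReal (Real.exp (-(a k * s))) :=
    fun k => by fun_prop
  rw [lintegral_tsum fun k => ((hm k).const_mul _).aemeasurable]
  exact tsum_congr fun k => lintegral_const_mul _ (hm k)

lemma ofReal_exp_neg_mul_add (x s u : ℝ) : ENNReal.ofReal (Real.exp (-(x * (s + u)))) =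
    ENNReal.ofReal (Real.exp (-(x * s))) * ENNReal.ofReal (Real.exp (-(x * u))) := by
  rw [← ENNReal.ofReal_mul (Real.exp_nonneg _), ← Real.exp_add]
  congr 2
  ring

lemma lintegral_transProb_add (hp : ∀ s, 0 ≤ s → transProb N μ c s 0 0 =
      ∑' k, w k * ENNReal.ofReal (Real.exp (-(a k * s)))) {S : Set ℝ} (hS : MeasurableSet S)
    (hS0 : ∀ u ∈ S, 0 ≤ u) {s : ℝ} (hs : 0 ≤ s) :
    ∫⁻ u in S, transProb N μ c (s + u) 0 0 =
      ∑' k, w k * (∫⁻ u in S, ENNReal.ofReal (Real.exp (-(a k * u)))) *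
        ENNReal.ofReal (Real.exp (-(a k * s))) := by
  have h1 : ∫⁻ u in S, transProb N μ c (s + u) 0 0 =
      ∫⁻ u in S, ∑' k, w k * ENNReal.ofReal (Real.exp (-(a k * s))) *
        ENNReal.ofReal (Real.exp (-(a k * u))) := by
    refine setLIntegral_congr_fun hS fun u hu => ?_
    rw [hp (s + u) (add_nonneg hs (hS0 u hu))]
    refine tsum_congr fun k => ?_
    rw [ofReal_exp_neg_mul_add, mul_assoc]
  rw [h1, lintegral_tsum_exp_neg_mul]
  exact tsum_congr fun k => mul_right_comm _ _ _

lemma f2_eq_tsum (ha : ∀ k, 0 < a k)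
    (hp : ∀ s, 0 ≤ s → transProb N μ c s 0 0 =
      ∑' k, w k * ENNReal.ofReal (Real.exp (-(a k * s)))) {t : ℝ} (ht : 0 < t) :
    f2 N μ c t =
      ∑' k, w k * ENNReal.ofReal (a k ^ (-2 : ℝ) * (1 - Real.exp (-(a k * t))) ^ 2) := by
  rw [f2_eq, setLIntegral_congr_fun measurableSet_Ioc fun s hs =>
    lintegral_transProb_add hp measurableSet_Ioc (fun u hu => hu.1.le) hs.1.le,
    lintegral_tsum_exp_neg_mul]
  refine tsum_congr fun k => ?_
  have h0 := one_sub_exp_neg_mem (mul_pos (ha k) ht)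
  have hk := ha k
  rw [lintegral_Ioc_exp_neg_mul hk ht, mul_assoc,
    ← ENNReal.ofReal_mul (div_nonneg h0.1 hk.le), Real.rpow_neg hk.le]
  congr 2
  norm_cast
  field_simp

/-- On each exponential, `G` contributes `1 / a` and each `G_t` contributes `(1 - exp(-a t)) / a`.
-/
lemma f3_eq_tsum (ha : ∀ k, 0 < a k)
    (hp : ∀ s, 0 ≤ s → transProb N μ c s 0 0 =
      ∑' k, w k * ENNReal.ofReal (Real.exp (-(a k * s)))) {t : ℝ} (ht : 0 < t) :
    f3 N μ c t =
      ∑' k, w k * ENNReal.ofReal (a k ^ (-3 : ℝ) * (1 - Real.exp (-(a k * t))) ^ 2) := by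
  have h1 : ∀ r ∈ Set.Ioc 0 t, ∫⁻ s in Set.Ioc 0 t, ∫⁻ u in Set.Ioi 0,
      transProb N μ c (r + (s + u)) 0 0 =
      ∑' k, w k * ENNReal.ofReal (1 / a k) *
        ENNReal.ofReal ((1 - Real.exp (-(a k * t))) / a k) *
          ENNReal.ofReal (Real.exp (-(a k * r))) := by
    intro r hr
    have h2 : ∀ s ∈ Set.Ioc 0 t, ∫⁻ u in Set.Ioi 0, transProb N μ c (r + (s + u)) 0 0 =
        ∑' k, w k * ENNReal.ofReal (1 / a k) * ENNReal.ofReal (Real.exp (-(a k * r))) *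
          ENNReal.ofReal (Real.exp (-(a k * s))) := by
      intro s hs
      simp only [← add_assoc]
      rw [lintegral_transProb_add hp measurableSet_Ioi (fun u (hu : 0 < u) => hu.le)
        (add_nonneg hr.1.le hs.1.le)]
      refine tsum_congr fun k => ?_
      rw [lintegral_Ioi_exp_neg_mul (ha k), ofReal_exp_neg_mul_add, ← mul_assoc]
    rw [setLIntegral_congr_fun measurableSet_Ioc h2, lintegral_tsum_exp_neg_mul]
    refine tsum_congr fun k => ?_
    rw [lintegral_Ioc_exp_neg_mul (ha k) ht, mul_right_comm]
  rw [f3_eq, setLIntegral_congr_fun measurableSet_Ioc h1, lintegral_tsum_exp_neg_mul]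
  refine tsum_congr fun k => ?_
  have h0 := one_sub_exp_neg_mem (mul_pos (ha k) ht)
  have hk := ha k
  rw [lintegral_Ioc_exp_neg_mul hk ht, mul_assoc, mul_assoc,
    ← ENNReal.ofReal_mul (div_nonneg h0.1 hk.le), ← ENNReal.ofReal_mul (by positivity),
    Real.rpow_neg hk.le]
  congr 2
  norm_cast
  field_simp

lemma f1_eq_gInc (t : ℝ) : f1 N 1 c t = gInc N 1 c 1 t := by
  unfold f1 gInc
  rw [incPotential_deltaZero]
  simp

end Functionals

end HierarchicalWalk

/-! ### The theorem: the cutoff profile of each functional -/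

theorem mainTheorem3 (N : ℕ) (hN : 2 ≤ N) (μ : ℝ) (hμ : 0 < μ) (c : ℕ → ℝ)
    (hc : ∀ j, 0 < c j)
    (hsum : Summable fun j : ℕ => c j / (N : ℝ) ^ ((j : ℝ) / μ))
    (hmono : ∀ j, HierarchicalWalk.dSeq N μ c j ≤ HierarchicalWalk.dSeq N μ c (j + 1))
    (hdiv : ¬ Summable fun j : ℕ => 1 / HierarchicalWalk.dSeq N μ c j ^ μ) :
    (μ = 1 →
      (∀ t : ℝ, 0 < t → HierarchicalWalk.f1 N μ c t < ⊤) ∧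
      (fun t : ℝ => (HierarchicalWalk.f1 N μ c t).toReal)
        ~[Filter.atTop] HierarchicalWalk.growth N μ c) ∧
    (μ = 2 →
      (∀ t : ℝ, 0 < t → HierarchicalWalk.f2 N μ c t < ⊤) ∧
      (fun t : ℝ => (HierarchicalWalk.f2 N μ c t).toReal)
        ~[Filter.atTop] HierarchicalWalk.growth N μ c) ∧
    (μ = 3 →
      (∀ t : ℝ, 0 < t → HierarchicalWalk.f3 N μ c t < ⊤) ∧
      (fun t : ℝ => (HierarchicalWalk.f3 N μ c t).toReal)
        ~[Filter.atTop] HierarchicalWalk.growth N μ c) ∧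
    ((∀ t : ℝ, 0 < t → HierarchicalWalk.gInc N μ c μ t < ⊤) ∧
      (fun t : ℝ => (HierarchicalWalk.gInc N μ c μ t).toReal)
        ~[Filter.atTop] HierarchicalWalk.growth N μ c) := by
  open HierarchicalWalk in
  have hg : (∀ t : ℝ, 0 < t → gInc N μ c μ t < ⊤) ∧
      (fun t : ℝ => (gInc N μ c μ t).toReal) ~[Filter.atTop] growth N μ c := by
    have hΓ := Real.Gamma_pos_of_pos hμ
    exact finite_and_isEquivalent_growth hN hμ hc hsum hmono hdiv hμ le_rfl
      (C := 1 / Real.Gamma μ * (1 / μ)) (by positivity) (fun x => gammaCdf_nonneg hμ)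
      (fun x => gammaCdf_le_one hμ) (fun x => gammaCdf_le hμ) (tendsto_gammaCdf hμ)
      fun t ht a ha hp => gInc_eq_tsum hμ ha hp ht
  have hF0 : ∀ x : ℝ, 0 < x → 0 ≤ (1 - Real.exp (-x)) ^ 2 := fun x _ => sq_nonneg _
  have hF1 : ∀ x : ℝ, 0 < x → (1 - Real.exp (-x)) ^ 2 ≤ 1 := fun x hx =>
    pow_le_one₀ (HierarchicalWalk.one_sub_exp_neg_mem hx).1
      (HierarchicalWalk.one_sub_exp_neg_mem hx).2.1
  have hF2 : ∀ x : ℝ, 0 < x → (1 - Real.exp (-x)) ^ 2 ≤ 1 * x ^ (2 : ℝ) := fun x hx => by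
    rw [one_mul, Real.rpow_two]
    exact pow_le_pow_left₀ (HierarchicalWalk.one_sub_exp_neg_mem hx).1
      (HierarchicalWalk.one_sub_exp_neg_mem hx).2.2 2
  refine ⟨?_, ?_, ?_, hg⟩
  · rintro rfl
    simpa only [HierarchicalWalk.f1_eq_gInc] using hg
  · rintro rfl
    exact HierarchicalWalk.finite_and_isEquivalent_growth hN hμ hc hsum hmono hdiv two_pos le_rfl
      zero_le_one hF0 hF1 hF2 HierarchicalWalk.tendsto_sq_one_sub_exp_neg
      fun t ht a ha hp => HierarchicalWalk.f2_eq_tsum ha hp ht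
  · rintro rfl
    -- Here `ν = 2 < μ = 3`: the full potential supplies a power of `1 / a` but no cutoff in `t`.
    exact HierarchicalWalk.finite_and_isEquivalent_growth hN hμ hc hsum hmono hdiv two_pos
      (by norm_num) zero_le_one hF0 hF1 hF2 HierarchicalWalk.tendsto_sq_one_sub_exp_neg
      fun t ht a ha hp => HierarchicalWalk.f3_eq_tsum ha hp ht
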